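/- Let $G=(V,E)$ be a countably infinite, locally finite graph, and let $V_1\subseteq V_2\subseteq\cdots$ be finite vertex sets with $\bigcup_i V_i=V$. For finite $K\subset V$ let $E(K)$ be the set of edges with both endpoints in $K$, let $\partial K$ be the set of $x\in K$ having a neighbour outside $K$, and put $E_i=E(V_i)$. Order $\{0,1\}^E$ coordinatewise ($\preccurlyeq$); $1$ means open. *Random-cluster measures.* Let $p\in[0,1]$, $q\ge 1$. ${\sf FRC}^{G,K}_{p,q}$ (resp. ${\sf WRC}^{G,K}_{p,q}$) is the probability measure on $\{0,1\}^E$ under which all edges outside $E(K)$ are closed (resp. open) and $\xi\in\{0,1\}^{E(K)}$ has probability proportional to $q^{k(\xi)}\prod_{e\in E(K)}p^{\xi(e)}(1-p)^{1-\xi(e)}$, where $k(\xi)$ is the number of connected components of the graph $(K,\{e\in E(K):\xi(e)=1\})$ (resp. the number of those components that do not intersect $\partial K$). Write ${\sf FRC}^{G,i}={\sf FRC}^{G,V_i}$, ${\sf WRC}^{G,i}={\sf WRC}^{G,V_i}$. The infinite-volume measures ${\sf FRC}^{G}_{p,q}$, ${\sf WRC}^{G}_{p,q}$ are the limits, on cylinder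 events, of ${\sf FRC}^{G,K_j}_{p,q}$, ${\sf WRC}^{G,K_j}_{p,q}$ along any increasing sequence of finite sets $K_j$ with union $V$. *Construction.* Let $\phi^e_k$ (exponential with mean $1$) and $U^e_k$ (uniform on $[0,1]$), $e\in E$, $k\ge1$, be independent, and put $\tau^e_k=\phi^e_1+\dots+\phi^e_k$. For $T\ge 0$, the free (resp. wired) chain in $V_i$ is started at time $-T$ from the all-closed (resp. all-open) configuration and run up to time $0$; an edge $e=\langle x,y\rangle\in E_i$ is updated exactly at the times $-\tau^e_k\in(-T,0]$, and all other edges never change. At time $-\tau^e_k$ the edge $e$ becomes open if $U^e_k<p$ and $x,y$ are connected by open edges of $E_i\setminus\{e\}$ (resp. $x,y$ are so connected or are both so connected to $\partial V_i$); if this connection is absent, $e$ becomes open if $U^e_k<\frac{p}{p+(1-p)q}$; otherwise it becomes closed. Let ${}^{\rm free}X^{G,i}_{p,q}$ (resp. ${}^{\rm wired}X^{G,i}_{p,q}$) be the limit as $T\to\infty$ of the configuration at time $0$, and let ${}^{\rm free}X^{G}_{p,q}$, ${}^{\rm wired}X^{G}_{p,q}$ be the coordinatewise limits of these as $i\to\infty$.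 *Claims.* 1. Almost surely, all these limits exist, for all $p\in[0,1]$, $q\ge1$ and $i$ simultaneously. 2. For all $p\in[0,1]$, $q\ge 1$ and $i$, the configurations ${}^{\rm free}X^{G,i}_{p,q}$, ${}^{\rm wired}X^{G,i}_{p,q}$, ${}^{\rm free}X^{G}_{p,q}$, ${}^{\rm wired}X^{G}_{p,q}$ have distributions ${\sf FRC}^{G,i}_{p,q}$, ${\sf WRC}^{G,i}_{p,q}$, ${\sf FRC}^{G}_{p,q}$, ${\sf WRC}^{G}_{p,q}$ respectively (in particular, the limits defining the last two measures exist and do not depend on the sequence $(K_j)$). 3. Almost surely, simultaneously for all parameters: (a) ${}^{\rm free}X^{G,1}_{p,q}\preccurlyeq{}^{\rm free}X^{G,2}_{p,q}\preccurlyeq\cdots\preccurlyeq{}^{\rm free}X^{G}_{p,q}\preccurlyeq{}^{\rm wired}X^{G}_{p,q}\preccurlyeq\cdots\preccurlyeq{}^{\rm wired}X^{G,2}_{p,q}\preccurlyeq{}^{\rm wired}X^{G,1}_{p,q}$; (b) if $p_1\le p_2$, then ${}^{b}X^{G,i}_{p_1,q}\preccurlyeq{}^{b}X^{G,i}_{p_2,q}$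 for all $i$ and ${}^{b}X^{G}_{p_1,q}\preccurlyeq{}^{b}X^{G}_{p_2,q}$, for $b\in\{\text{free},\text{wired}\}$; (c) if $p_1\le p_2$ and $\frac{p_1}{(1-p_1)q_1}\le\frac{p_2}{(1-p_2)q_2}$ (with value $+\infty$ when the corresponding $p_j=1$), then ${}^{b}X^{G}_{p_1,q_1}\preccurlyeq{}^{b}X^{G}_{p_2,q_2}$ for $b\in\{\text{free},\text{wired}\}$ and ${}^{\rm free}X^{G}_{p_1,q_1}\preccurlyeq{}^{\rm wired}X^{G}_{p_2,q_2}$, and likewise with $G$ replaced by $G,i$ for every $i$. 4. For every automorphism $\gamma$ of $G$, the joint law of the whole family $({}^{\rm free}X^{G}_{p,q},{}^{\rm wired}X^{G}_{p,q})_{p\in[0,1],\,q\ge1}$ is invariant under relabelling the edges by $\gamma$. -/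

import Mathlib

open Filter Topology MeasureTheory ProbabilityTheory Set

noncomputable section

namespace RandomCluster

/-- Admissible parameters of the random-cluster model: `p ∈ [0,1]` and `q ≥ 1`. -/
structure Param where
  p : ℝ
  q : ℝ
  p_nonneg : 0 ≤ p
  p_le_one : p ≤ 1
  one_le_q : 1 ≤ q

/-- The ratio `p / ((1 - p) q)` as an element of `[0, ∞]`; it is `∞` for `p = 1`. -/
def Param.odds (θ : Param) : ENNReal :=
  ENNReal.ofReal θ.p / (ENNReal.ofReal (1 - θ.p) * ENNReal.ofReal θ.q)

/-- The two boundary conditions. -/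
inductive BC
  | free
  | wired

/-- The state of the edges outside the finite volume, and also the initial state of all edges:
closed for the free, open for the wired boundary condition. -/
def BC.state : BC → Bool
  | .free => false
  | .wired => true

variable {V : Type*}

/-- Edge configurations `{0,1}^E`, with the product order and the product σ-algebra. -/
abbrev Config (G : SimpleGraph V) : Type _ := G.edgeSet → Bool

open Classical in
/-- `E(K)`: the edges of `G` with both endpoints in the finite vertex set `K`. -/
def edgesIn (G : SimpleGraph V) (K : Finset V) : Finset G.edgeSet :=
  K.sym2.subtype (· ∈ G.edgeSet)

/-- The inner vertex boundary `∂K`. -/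
def innerBoundary (G : SimpleGraph V) (K : Finset V) : Set V :=
  {x | x ∈ K ∧ ∃ y, y ∉ K ∧ G.Adj x y}

/-- The graph with vertex set `K` and the edges of `E(K)` that are open in `ξ`. -/
def openGraph (G : SimpleGraph V) (K : Finset V) (ξ : Config G) : SimpleGraph K where
  Adj x y := ∃ h : G.Adj x y, ξ ⟨s((x : V), (y : V)), h⟩ = true
  symm := ⟨by
    rintro x y ⟨h, hξ⟩
    refine ⟨h.symm, ?_⟩
    rw [← hξ]
    congr 2
    exact Sym2.eq_swap⟩
  loopless := ⟨fun x h => G.loopless.irrefl _ h.1⟩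

/-! ### Finite-volume and infinite-volume random-cluster measures -/

/-- Number of connected components of the open subgraph of `(K, E(K))`, where isolated vertices
count as components; for the wired boundary condition, only the components that do not
intersect `∂K` are counted. -/
def clusterCount (G : SimpleGraph V) (K : Finset V) (b : BC) (ξ : Config G) : ℕ :=
  match b with
  | .free => Nat.card (openGraph G K ξ).ConnectedComponent
  | .wired => Nat.card {c : (openGraph G K ξ).ConnectedComponent //
      ∀ x : K, (x : V) ∈ innerBoundary G K → (openGraph G K ξ).connectedComponentMk x ≠ c}

/-- The unnormalised random-cluster weight
`q ^ k(ξ) * ∏_{e ∈ E(K)} p ^ ξ(e) * (1 - p) ^ (1 - ξ(e))`. -/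
def weight (G : SimpleGraph V) (K : Finset V) (b : BC) (θ : Param) (ξ : Config G) : ℝ :=
  θ.q ^ clusterCount G K b ξ * ∏ e ∈ edgesIn G K, if ξ e = true then θ.p else 1 - θ.p

open Classical in
/-- Extend a configuration on `E(K)` to `E` by the state prescribed by the boundary condition. -/
def extend (G : SimpleGraph V) (K : Finset V) (b : BC) (ξ : edgesIn G K → Bool) : Config G :=
  fun e => if h : e ∈ edgesIn G K then ξ ⟨e, h⟩ else b.state

open Classical in
/-- The normalising constant. -/
def partitionFunction (G : SimpleGraph V) (K : Finset V) (b : BC) (θ : Param) : ℝ :=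
  ∑ ξ : edgesIn G K → Bool, weight G K b θ (extend G K b ξ)

open Classical in
/-- The finite-volume free / wired random-cluster measure in the volume `K`, as a measure on
`{0,1}^E`. -/
def finiteRC (G : SimpleGraph V) (K : Finset V) (b : BC) (θ : Param) : Measure (Config G) :=
  ∑ ξ : edgesIn G K → Bool,
    ENNReal.ofReal (weight G K b θ (extend G K b ξ) / partitionFunction G K b θ) •
      Measure.dirac (extend G K b ξ)

/-- An increasing sequence of finite vertex sets with union `V`. -/
structure IsExhaustion (W : ℕ → Finset V) : Prop where
  mono : Monotone W
  cover : ∀ x, ∃ i, x ∈ W i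

/-- `μ` is the infinite-volume free / wired random-cluster measure: the probability measure that
is the weak limit (convergence on cylinder events) of the finite-volume measures along every
exhaustion. -/
structure IsInfiniteRC (G : SimpleGraph V) (b : BC) (θ : Param) (μ : Measure (Config G)) :
    Prop where
  isProbabilityMeasure : IsProbabilityMeasure μ
  tendsto : ∀ W : ℕ → Finset V, IsExhaustion W →
    ∀ A ∈ measurableCylinders (fun _ : G.edgeSet => Bool),
      Tendsto (fun i => finiteRC G (W i) b θ A) atTop (𝓝 (μ A))

/-! ### The driving randomness -/

/-- The law of one pair `(φ, U)`: a mean one exponential variable and an independent uniform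
variable on `[0,1]`. -/
def markLaw : Measure (ℝ × ℝ) :=
  (expMeasure 1).prod (volume.restrict (Icc (0 : ℝ) 1))

instance : IsProbabilityMeasure markLaw := by
  have h1 : IsProbabilityMeasure (expMeasure 1) := isProbabilityMeasure_expMeasure one_pos
  have h2 : IsProbabilityMeasure (volume.restrict (Icc (0 : ℝ) 1)) := ⟨by simp⟩
  unfold markLaw
  infer_instance

/-- A realisation of the variables `(φ^e_{k+1}, U^e_{k+1})`, for `e ∈ E` and `k = 0, 1, 2, …`. -/
abbrev Sample (G : SimpleGraph V) : Type _ := G.edgeSet × ℕ → ℝ × ℝ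

/-- The law under which all the variables `φ^e_k`, `U^e_k` are independent. -/
def sampleLaw (G : SimpleGraph V) : Measure (Sample G) :=
  Measure.infinitePi fun _ : G.edgeSet × ℕ => markLaw

/-- The Poisson times `τ^e_{k+1} = φ^e_1 + ⋯ + φ^e_{k+1}`. -/
def clockTime {G : SimpleGraph V} (ω : Sample G) (e : G.edgeSet) (k : ℕ) : ℝ :=
  ∑ j ∈ Finset.range (k + 1), (ω (e, j)).1

/-! ### The dynamics from the past -/

open Classical in
/-- The endpoints of `e` are connected in `ξ` restricted to `E(K) \ {e}`: by an open path or, for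
the wired boundary condition, also by both being joined to `∂K` by open paths. -/
def Joined (G : SimpleGraph V) (K : Finset V) (b : BC) (ξ : Config G) (e : G.edgeSet) : Prop :=
  let H := openGraph G K (Function.update ξ e false)
  ∃ x y : K, (e : Sym2 V) = s((x : V), (y : V)) ∧
    (H.Reachable x y ∨
      (b = BC.wired ∧
        (∃ u : K, (u : V) ∈ innerBoundary G K ∧ H.Reachable x u) ∧
        (∃ v : K, (v : V) ∈ innerBoundary G K ∧ H.Reachable y v)))

open Classical in
/-- The conditional probability that `e` is open, given the other edges. -/
def openProb (G : SimpleGraph V) (K : Finset V) (b : BC) (θ : Param) (ξ : Config G)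
    (e : G.edgeSet) : ℝ :=
  if Joined G K b ξ e then θ.p else θ.p / (θ.p + (1 - θ.p) * θ.q)

open Classical in
/-- The updates at time `-s`: an edge `e ∈ E(K)` with `τ^e_k = s` becomes open if `U^e_k` is less
than `openProb`, and closed otherwise; the other edges keep their state.
(Almost surely at most one edge is updated, and there is only one such `k`.) -/
def step (G : SimpleGraph V) (K : Finset V) (b : BC) (θ : Param) (ω : Sample G)
    (ξ : Config G) (s : ℝ) : Config G :=
  fun e => if e ∈ edgesIn G K ∧ ∃ k, clockTime ω e k = s then
      decide (∃ k, clockTime ω e k = s ∧ (ω (e, k)).2 < openProb G K b θ ξ e)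
    else ξ e

/-- The `s` such that some edge of `E(K)` is updated at time `-s ∈ (-T, t]`. -/
def updateTimes (G : SimpleGraph V) (K : Finset V) (ω : Sample G) (T t : ℝ) : Set ℝ :=
  {s | s < T ∧ -t ≤ s ∧ ∃ e ∈ edgesIn G K, ∃ k, clockTime ω e k = s}

open Classical in
/-- The state at time `t ∈ [-T, 0]` of the chain in the volume `K` that is started at time `-T`
from the all-closed (free) or all-open (wired) configuration: the updates at the times
`-s ∈ (-T, t]` are carried out in chronological order, i.e. by decreasing `s`.
(Almost surely there are finitely many of them.) -/
def chain (G : SimpleGraph V) (K : Finset V) (b : BC) (θ : Param) (ω : Sample G) (T t : ℝ) :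
    Config G :=
  if h : (updateTimes G K ω T t).Finite then
    (h.toFinset.sort (· ≥ ·)).foldl (step G K b θ ω) (fun _ => b.state)
  else fun _ => b.state

/-- The finite-volume object: the limit as `T → ∞` of the state at time `0`. -/
def finiteX (G : SimpleGraph V) (K : Finset V) (b : BC) (θ : Param) (ω : Sample G) : Config G :=
  fun e => limUnder atTop fun T : ℝ => chain G K b θ ω T 0 e

/-- The infinite-volume object: the limit of the finite-volume objects along the exhaustion. -/
def infiniteX (G : SimpleGraph V) (W : ℕ → Finset V) (b : BC) (θ : Param) (ω : Sample G) :
    Config G :=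
  fun e => limUnder atTop fun i : ℕ => finiteX G (W i) b θ ω e

/-- All infinite-volume objects jointly: both boundary conditions and all parameter values. -/
def jointX (G : SimpleGraph V) (W : ℕ → Finset V) (ω : Sample G) : BC × Param → Config G :=
  fun a => infiniteX G W a.1 a.2 ω

/-- A graph automorphism acts on families of configurations by relabelling the edges. -/
def relabel {G : SimpleGraph V} (γ : G ≃g G) (X : BC × Param → Config G) :
    BC × Param → Config G :=
  fun a e => X a (γ.mapEdgeSet e)

end RandomCluster

end

noncomputable section

namespace RandomCluster

/-! ### Pathwise monotone coupling, and existence and order of the limits. -/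

section Coupling

/-! ### Sorted lists of update times -/

/-! The construction is coupling from the past for the heat-bath dynamics, with all chains driven by
the same clocks and marks.

Order. Since q ≥ 1, an edge whose endpoints are joined opens with probability p, which is at least
the value p/(p+(1-p)q) used otherwise; both thresholds increase along the stated order on
parameters. Hence a common mark preserves the order of two configurations (`openProb_mono`,
`CoupledLE.step`). Volumes are compared in the same way: an open path in a larger volume either
stays in the smaller volume or meets its boundary, so the wired connection event grows as the volume
shrinks, while the free one grows with the volume (`Joined.wired_anti`, `Joined.of_free`). A chain
started earlier is, at the later starting time, in some state above all-closed and below all-open.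
So every limit is a limit of a monotone Boolean function. All of this is deterministic once the
clocks do not explode, which gives one null set for all parameters.

Laws. Closing an edge creates one more counted cluster exactly when its endpoints are not joined;
this is detailed balance for the finite-volume measure (`clusterCount_update`, `weight_update`).
With the clocks fixed, the order of the updates is deterministic and the marks are fresh, so a
stationary start stays stationary (`sum_prob_lintegral_foldl`). Almost surely some stretch of time
resets every edge to one value whatever the state, so the starting configuration is forgotten
(`ae_exists_coalescence`) and the limit has the stationary law (`markFieldLaw_finiteX`,
`map_finiteX`).

Infinite volume. Two exhaustions interlace, hence give the same pathwise limit
(`infiniteX_eq_of_exhaustions`). Eventual equality on finitely many edges gives convergence on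
cylinders along every exhaustion. An automorphism only permutes the i.i.d. input and moves the
exhaustion, so the joint law is invariant. -/

lemma sort_ge_eq_of_pairwise {S : Finset ℝ} {l : List ℝ} (hl : l.Pairwise (· > ·))
    (hS : ∀ s, s ∈ l ↔ s ∈ S) : S.sort (· ≥ ·) = l := by
  have hnd : l.Nodup := hl.imp fun h => ne_of_gt h
  have hfs : l.toFinset = S := by ext s; simp [hS]
  rw [← hfs]
  exact (List.toFinset_sort (· ≥ ·) hnd).mpr (hl.imp fun h => le_of_lt h)

lemma sort_ge_pairwise (S : Finset ℝ) : (S.sort (· ≥ ·)).Pairwise (· > ·) :=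
  (Finset.sortedGT_sort S).pairwise

lemma sort_ge_eq_append (S : Finset ℝ) (T : ℝ) :
    S.sort (· ≥ ·) =
      (S.filter (T ≤ ·)).sort (· ≥ ·) ++ (S.filter (· < T)).sort (· ≥ ·) := by
  refine sort_ge_eq_of_pairwise ?_ ?_
  · rw [List.pairwise_append]
    refine ⟨sort_ge_pairwise _, sort_ge_pairwise _, ?_⟩
    intro a ha b hb
    simp only [Finset.mem_sort, Finset.mem_filter] at ha hb
    exact lt_of_lt_of_le hb.2 ha.2
  · intro s
    simp only [List.mem_append, Finset.mem_sort, Finset.mem_filter]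
    have := le_or_gt T s
    tauto

/-- Times that act trivially can be inserted freely, so chains in different volumes can be driven by
one common list. -/
lemma foldl_sort_of_subset {α : Type*} {f : α → ℝ → α} {S S' : Finset ℝ} (h : S' ⊆ S)
    (hf : ∀ s ∈ S, s ∉ S' → ∀ a, f a s = a) (a : α) :
    (S.sort (· ≥ ·)).foldl f a = (S'.sort (· ≥ ·)).foldl f a := by
  have h1 : S'.sort (· ≥ ·) = (S.sort (· ≥ ·)).filter (fun s => decide (s ∈ S')) := by
    refine sort_ge_eq_of_pairwise ((sort_ge_pairwise S).filter _) ?_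
    intro s
    simp only [List.mem_filter, Finset.mem_sort, decide_eq_true_eq]
    exact ⟨fun hs => hs.2, fun hs => ⟨h hs, hs⟩⟩
  rw [h1, List.foldl_filter]
  refine List.foldl_ext _ _ _ fun b s hs => ?_
  by_cases hs' : s ∈ S'
  · simp [hs']
  · simp [hs', hf s ((Finset.mem_sort _).1 hs) hs' b]

lemma foldl_rel {α β γ : Type*} {R : α → β → Prop} {f : α → γ → α} {g : β → γ → β}
    (h : ∀ a b s, R a b → R (f a s) (g b s)) (l : List γ) {a : α} {b : β} (hab : R a b) :
    R (l.foldl f a) (l.foldl g b) := by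
  induction l generalizing a b with
  | nil => exact hab
  | cons s l ih => exact ih (h _ _ _ hab)

variable {V : Type*} {G : SimpleGraph V}

/-- All clocks ring finitely often in bounded time. -/
def Nonexplosive (ω : Sample G) : Prop := ∀ e, Tendsto (clockTime ω e) atTop atTop

lemma Nonexplosive.finite_updateTimes {ω : Sample G} (hω : Nonexplosive ω) (K : Finset V)
    (T t : ℝ) : (updateTimes G K ω T t).Finite := by
  have h : updateTimes G K ω T t ⊆
      ⋃ e ∈ edgesIn G K, clockTime ω e '' {k | clockTime ω e k < T} := by
    rintro s ⟨hs, -, e, he, k, rfl⟩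
    exact mem_biUnion he ⟨k, hs, rfl⟩
  refine Set.Finite.subset ?_ h
  refine (edgesIn G K).finite_toSet.biUnion fun e _ => Set.Finite.image _ ?_
  have := ((hω e).eventually_ge_atTop T)
  rw [← Nat.cofinite_eq_atTop, Filter.eventually_cofinite] at this
  simpa using this

open Classical in
/-- The update times in `[0, T)`. -/
def updateFinset (G : SimpleGraph V) (K : Finset V) (ω : Sample G) (T : ℝ) : Finset ℝ :=
  if h : (updateTimes G K ω T 0).Finite then h.toFinset else ∅

/-- The state at time `0` of the chain started at time `-T` from `ξ`. -/
def run (G : SimpleGraph V) (K : Finset V) (b : BC) (θ : Param) (ω : Sample G) (T : ℝ)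
    (ξ : Config G) : Config G :=
  ((updateFinset G K ω T).sort (· ≥ ·)).foldl (step G K b θ ω) ξ

lemma chain_eq_run (K : Finset V) (b : BC) (θ : Param) (ω : Sample G) (T : ℝ) :
    chain G K b θ ω T 0 = run G K b θ ω T (fun _ => b.state) := by
  unfold chain run updateFinset
  split_ifs with h
  · rfl
  -- With infinitely many update times `updateFinset` is empty, so `run` also returns the initial
  -- state; no condition on `ω` is needed.
  · simp

lemma Nonexplosive.mem_updateFinset {ω : Sample G} (hω : Nonexplosive ω) {K : Finset V}
    {T s : ℝ} : s ∈ updateFinset G K ω T ↔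
      s < T ∧ 0 ≤ s ∧ ∃ e ∈ edgesIn G K, ∃ k, clockTime ω e k = s := by
  unfold updateFinset
  rw [dif_pos (hω.finite_updateTimes K T 0), Set.Finite.mem_toFinset]
  simp only [updateTimes, mem_ofPred_eq, neg_zero]

lemma mem_edgesIn {K : Finset V} {e : G.edgeSet} :
    e ∈ edgesIn G K ↔ ∀ x ∈ (e : Sym2 V), x ∈ K := by
  simp [edgesIn, Finset.mem_sym2_iff]

lemma mk_mem_edgesIn {K : Finset V} {x y : V} (h : s(x, y) ∈ G.edgeSet) :
    (⟨s(x, y), h⟩ : G.edgeSet) ∈ edgesIn G K ↔ x ∈ K ∧ y ∈ K := by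
  simp [mem_edgesIn]

lemma edgesIn_mono {K K' : Finset V} (h : K ⊆ K') : edgesIn G K ⊆ edgesIn G K' := by
  intro e he
  rw [mem_edgesIn] at he ⊢
  exact fun x hx => h (he x hx)

lemma step_apply_of_notMem {K : Finset V} {b : BC} {θ : Param} {ω : Sample G} {ξ : Config G}
    {s : ℝ} {e : G.edgeSet} (he : e ∉ edgesIn G K) : step G K b θ ω ξ s e = ξ e := by
  simp [step, he]

lemma run_apply_of_notMem {K : Finset V} {b : BC} {θ : Param} {ω : Sample G} {ξ : Config G}
    {T : ℝ} {e : G.edgeSet} (he : e ∉ edgesIn G K) : run G K b θ ω T ξ e = ξ e := by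
  unfold run
  exact foldl_rel (R := fun a b : Config G => a e = b e) (g := fun a _ => a)
    (fun a b s hab => by rw [step_apply_of_notMem he, hab]) _ rfl |>.trans (by simp)

lemma run_eq_foldl_of_subset {ω : Sample G} (hω : Nonexplosive ω) {K K' : Finset V} (h : K ⊆ K')
    (b : BC) (θ : Param) (T : ℝ) (ξ : Config G) :
    run G K b θ ω T ξ =
      ((updateFinset G K' ω T).sort (· ≥ ·)).foldl (step G K b θ ω) ξ := by
  refine (foldl_sort_of_subset ?_ ?_ ξ).symm
  · intro s
    rw [hω.mem_updateFinset, hω.mem_updateFinset]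
    rintro ⟨h1, h2, e, he, hk⟩
    exact ⟨h1, h2, e, edgesIn_mono h he, hk⟩
  · intro s hs hs' a
    rw [hω.mem_updateFinset] at hs hs'
    funext e
    refine if_neg ?_
    rintro ⟨he, hk⟩
    exact hs' ⟨hs.1, hs.2.1, e, he, hk⟩

/-- Flow property: `ξ'` is the state at time `-T` of the chain started at `-T'`. -/
lemma run_add {ω : Sample G} (hω : Nonexplosive ω) (K : Finset V) (b : BC) (θ : Param) {T T' : ℝ}
    (h : T ≤ T') (ξ : Config G) :
    ∃ ξ', run G K b θ ω T' ξ = run G K b θ ω T ξ' := by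
  refine ⟨(((updateFinset G K ω T').filter (T ≤ ·)).sort (· ≥ ·)).foldl (step G K b θ ω) ξ, ?_⟩
  unfold run
  rw [sort_ge_eq_append _ T, List.foldl_append]
  congr 2
  ext s
  simp only [Finset.mem_filter, hω.mem_updateFinset]
  constructor
  · tauto
  · rintro ⟨h1, h2⟩
    exact ⟨⟨h1.trans_le h, h2⟩, h1⟩

/-! ### Monotonicity of the connection events -/

lemma openGraph_reachable_mono {K K' : Finset V} (hK : K ⊆ K') {ξ ξ' : Config G}
    (h : ∀ e ∈ edgesIn G K, ξ e ≤ ξ' e) {x y : K} (hxy : (openGraph G K ξ).Reachable x y) :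
    (openGraph G K' ξ').Reachable ⟨x, hK x.2⟩ ⟨y, hK y.2⟩ := by
  let f : openGraph G K ξ →g openGraph G K' ξ' :=
    { toFun := fun x => ⟨x, hK x.2⟩
      map_rel' := by
        rintro a b ⟨hab, hξ⟩
        refine ⟨hab, ?_⟩
        have := h ⟨s((a : V), (b : V)), hab⟩ ((mk_mem_edgesIn _).2 ⟨a.2, b.2⟩)
        rw [hξ] at this
        exact Bool.le_iff_imp.1 this rfl }
  exact hxy.map f

/-- Follow the path from `x` until it first leaves `K`: the last vertex before the exit has a
neighbour outside `K`, hence lies in `∂K`. -/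
lemma openGraph_reachable_or_boundary {K K' : Finset V} {ξ ξ' : Config G}
    (h : ∀ e ∈ edgesIn G K, ξ' e ≤ ξ e) {x : K} {x' z : K'} (hx : (x' : V) = x)
    (hxz : (openGraph G K' ξ').Reachable x' z) :
    (∃ hz : (z : V) ∈ K, (openGraph G K ξ).Reachable x ⟨z, hz⟩) ∨
      ∃ u : K, (u : V) ∈ innerBoundary G K ∧ (openGraph G K ξ).Reachable x u := by
  rw [SimpleGraph.reachable_iff_reflTransGen] at hxz
  induction hxz with
  | refl =>
    refine Or.inl ⟨hx ▸ x.2, ?_⟩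
    have : (⟨(x' : V), hx ▸ x.2⟩ : K) = x := Subtype.ext hx
    rw [this]
  | @tail y z _ hbc ih =>
    rcases ih with ⟨hy, hr⟩ | hu
    · obtain ⟨hadj, hopen⟩ := hbc
      by_cases hz : (z : V) ∈ K
      · refine Or.inl ⟨hz, hr.trans (SimpleGraph.Adj.reachable ⟨hadj, ?_⟩)⟩
        have := h ⟨s((y : V), (z : V)), hadj⟩ ((mk_mem_edgesIn _).2 ⟨hy, hz⟩)
        rw [hopen] at this
        exact Bool.le_iff_imp.1 this rfl
      · exact Or.inr ⟨⟨y, hy⟩, ⟨hy, z, hz, hadj⟩, hr⟩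
    · exact Or.inr hu

lemma update_false_mono {K : Finset V} {ξ ξ' : Config G} (e : G.edgeSet)
    [DecidableEq G.edgeSet] (h : ∀ e ∈ edgesIn G K, ξ e ≤ ξ' e) :
    ∀ f ∈ edgesIn G K, Function.update ξ e false f ≤ Function.update ξ' e false f := by
  intro f hf
  by_cases hfe : f = e
  · simp [hfe]
  · simpa [Function.update_of_ne hfe] using h f hf

lemma Joined.of_free {K K' : Finset V} (hK : K ⊆ K') {ξ ξ' : Config G}
    (h : ∀ e ∈ edgesIn G K, ξ e ≤ ξ' e) {e : G.edgeSet} (b : BC)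
    (hJ : Joined G K .free ξ e) : Joined G K' b ξ' e := by
  classical
  obtain ⟨x, y, he, hxy⟩ := hJ
  rcases hxy with hxy | hxy
  · exact ⟨⟨x, hK x.2⟩, ⟨y, hK y.2⟩, he,
      Or.inl (openGraph_reachable_mono hK (update_false_mono e h) hxy)⟩
  · exact absurd hxy.1 (by simp)

/-- A path leaving `K` joins both of its ends to `∂K`, provided these lie in `K`, and a path ending
at `∂K'` either meets `∂K` on the way or ends in `∂K' ∩ K ⊆ ∂K`. -/
lemma Joined.wired_anti {K K' : Finset V} (hK : K ⊆ K') {ξ ξ' : Config G}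
    (h : ∀ e ∈ edgesIn G K, ξ' e ≤ ξ e) {e : G.edgeSet} (he : e ∈ edgesIn G K)
    (hJ : Joined G K' .wired ξ' e) : Joined G K .wired ξ e := by
  classical
  obtain ⟨x, y, hxy, hJ⟩ := hJ
  have hm : ∀ z ∈ (e : Sym2 V), z ∈ K := mem_edgesIn.1 he
  have hx : (x : V) ∈ K := hm _ (by simp [hxy])
  have hy : (y : V) ∈ K := hm _ (by simp [hxy])
  have hu := update_false_mono e h
  have key : ∀ (a : K') (ha : (a : V) ∈ K),
      (∃ u : K', (u : V) ∈ innerBoundary G K' ∧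
        (openGraph G K' (Function.update ξ' e false)).Reachable a u) →
      ∃ u : K, (u : V) ∈ innerBoundary G K ∧
        (openGraph G K (Function.update ξ e false)).Reachable ⟨a, ha⟩ u := by
    rintro a ha ⟨u, hub, hau⟩
    rcases openGraph_reachable_or_boundary hu (x := ⟨a, ha⟩) (x' := a) rfl hau with ⟨huK, hr⟩ | hr
    -- A neighbour outside `K'` is also outside `K`.
    · obtain ⟨-, w, hw, hadj⟩ := hub
      exact ⟨⟨u, huK⟩, ⟨huK, w, fun hwK => hw (hK hwK), hadj⟩, hr⟩
    · exact hr
  refine ⟨⟨x, hx⟩, ⟨y, hy⟩, hxy, ?_⟩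
  rcases hJ with hr | ⟨-, h1, h2⟩
  · rcases openGraph_reachable_or_boundary hu (x := ⟨x, hx⟩) (x' := x) rfl hr with ⟨_, h1⟩ | h1
    · exact Or.inl h1
    -- Reversing the path shows that `y` too is joined to `∂K`, unless it reaches `x` inside `K`.
    · rcases openGraph_reachable_or_boundary hu (x := ⟨y, hy⟩) (x' := y) rfl hr.symm with ⟨_, h2⟩ | h2
      · exact Or.inl h2.symm
      · exact Or.inr ⟨rfl, h1, h2⟩
  · exact Or.inr ⟨rfl, key x hx h1, key y hy h2⟩

lemma Joined.mono {K : Finset V} {ξ ξ' : Config G} (h : ∀ e ∈ edgesIn G K, ξ e ≤ ξ' e) {b : BC}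
    {e : G.edgeSet} (he : e ∈ edgesIn G K) (hJ : Joined G K b ξ e) : Joined G K b ξ' e := by
  cases b
  · exact hJ.of_free subset_rfl h _
  · exact hJ.wired_anti subset_rfl h he

/-! ### Parameters -/

/-- The probability of opening an edge whose endpoints are not joined. -/
def Param.low (θ : Param) : ℝ := θ.p / (θ.p + (1 - θ.p) * θ.q)

lemma Param.denom_pos (θ : Param) : 0 < θ.p + (1 - θ.p) * θ.q := by
  nlinarith [θ.p_nonneg, θ.p_le_one, θ.one_le_q,
    mul_nonneg (sub_nonneg.2 θ.p_le_one) (sub_nonneg.2 θ.one_le_q)]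

lemma Param.low_nonneg (θ : Param) : 0 ≤ θ.low := div_nonneg θ.p_nonneg θ.denom_pos.le

lemma Param.low_le_p (θ : Param) : θ.low ≤ θ.p := by
  unfold Param.low
  rw [div_le_iff₀ θ.denom_pos]
  nlinarith [mul_nonneg θ.p_nonneg
    (mul_nonneg (sub_nonneg.2 θ.p_le_one) (sub_nonneg.2 θ.one_le_q))]

/-- The order on parameters under which the configurations are monotone. -/
structure Param.Le (θ₁ θ₂ : Param) : Prop where
  p_le : θ₁.p ≤ θ₂.p
  low_le : θ₁.low ≤ θ₂.low

/-- After clearing denominators the term `p₁p₂` cancels, leaving the comparison of the odds; in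
cross-multiplied form it also makes sense at `p = 1`. -/
lemma Param.Le.of_cross {θ₁ θ₂ : Param} (h : θ₁.p ≤ θ₂.p)
    (h' : θ₁.p * ((1 - θ₂.p) * θ₂.q) ≤ θ₂.p * ((1 - θ₁.p) * θ₁.q)) : θ₁.Le θ₂ := by
  refine ⟨h, ?_⟩
  unfold Param.low
  rw [div_le_div_iff₀ θ₁.denom_pos θ₂.denom_pos]
  nlinarith

lemma Param.Le.refl (θ : Param) : θ.Le θ := ⟨le_rfl, le_rfl⟩

lemma Param.Le.of_q_eq {θ₁ θ₂ : Param} (hq : θ₁.q = θ₂.q) (h : θ₁.p ≤ θ₂.p) : θ₁.Le θ₂ := by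
  refine .of_cross h ?_
  rw [hq]
  have : 0 ≤ θ₂.q := zero_le_one.trans θ₂.one_le_q
  nlinarith [mul_nonneg this (sub_nonneg.2 h)]

lemma Param.Le.of_odds {θ₁ θ₂ : Param} (h : θ₁.p ≤ θ₂.p) (h' : θ₁.odds ≤ θ₂.odds) :
    θ₁.Le θ₂ := by
  refine .of_cross h ?_
  have q1 := zero_lt_one.trans_le θ₁.one_le_q
  have q2 := zero_lt_one.trans_le θ₂.one_le_q
  rcases θ₂.p_le_one.eq_or_lt with h2 | h2
  · rw [h2]
    have := mul_nonneg (sub_nonneg.2 θ₁.p_le_one) q1.le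
    simpa using this
  have h1 : θ₁.p < 1 := h.trans_lt h2
  have d1 : 0 < (1 - θ₁.p) * θ₁.q := mul_pos (sub_pos.2 h1) q1
  have d2 : 0 < (1 - θ₂.p) * θ₂.q := mul_pos (sub_pos.2 h2) q2
  unfold Param.odds at h'
  rw [← ENNReal.ofReal_mul (sub_pos.2 h1).le, ← ENNReal.ofReal_mul (sub_pos.2 h2).le,
    ← ENNReal.ofReal_div_of_pos d1, ← ENNReal.ofReal_div_of_pos d2,
    ENNReal.ofReal_le_ofReal_iff (div_nonneg θ₂.p_nonneg d2.le), div_le_div_iff₀ d1 d2] at h'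
  exact h'

lemma openProb_mono {K₁ K₂ : Finset V} {b₁ b₂ : BC} {θ₁ θ₂ : Param} (hθ : θ₁.Le θ₂)
    {ξ₁ ξ₂ : Config G} {e : G.edgeSet} (hJ : Joined G K₁ b₁ ξ₁ e → Joined G K₂ b₂ ξ₂ e) :
    openProb G K₁ b₁ θ₁ ξ₁ e ≤ openProb G K₂ b₂ θ₂ ξ₂ e := by
  unfold openProb
  split_ifs with h1 h2 h2
  · exact hθ.p_le
  · exact absurd (hJ h1) h2
  -- Only the second configuration is joined: here `q ≥ 1` is essential, through `low ≤ p`.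
  · exact hθ.low_le.trans θ₂.low_le_p
  · exact hθ.low_le

lemma low_le_openProb (K : Finset V) (b : BC) (θ : Param) (ξ : Config G) (e : G.edgeSet) :
    θ.low ≤ openProb G K b θ ξ e := by
  unfold openProb
  split_ifs
  · exact θ.low_le_p
  · exact le_rfl

lemma openProb_le_p (K : Finset V) (b : BC) (θ : Param) (ξ : Config G) (e : G.edgeSet) :
    openProb G K b θ ξ e ≤ θ.p := by
  unfold openProb
  split_ifs
  · exact le_rfl
  · exact θ.low_le_p

/-! ### Monotone coupling -/

/-- The order relation between configurations in the volumes `K₁` and `K₂` which the dynamics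
preserves. -/
structure CoupledLE (G : SimpleGraph V) (K₁ K₂ : Finset V) (ξ₁ ξ₂ : Config G) : Prop where
  le : ξ₁ ≤ ξ₂
  upper : ∀ e ∈ edgesIn G K₁, e ∉ edgesIn G K₂ → ξ₂ e = true
  lower : ∀ e ∈ edgesIn G K₂, e ∉ edgesIn G K₁ → ξ₁ e = false

/-- The connection event of `(K₁, b₁)` implies that of `(K₂, b₂)` for ordered configurations. -/
def JoinedLE (G : SimpleGraph V) (K₁ K₂ : Finset V) (b₁ b₂ : BC) : Prop :=
  ∀ ξ₁ ξ₂ : Config G, ξ₁ ≤ ξ₂ → ∀ e ∈ edgesIn G K₁, e ∈ edgesIn G K₂ →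
    Joined G K₁ b₁ ξ₁ e → Joined G K₂ b₂ ξ₂ e

/-- On common edges the same mark is compared with ordered thresholds. An edge updated in one volume
only is frozen in the other chain at the extreme value on the correct side, so its update cannot
break the order. -/
lemma CoupledLE.step {K₁ K₂ : Finset V} {b₁ b₂ : BC} {θ₁ θ₂ : Param} {ξ₁ ξ₂ : Config G}
    (h : CoupledLE G K₁ K₂ ξ₁ ξ₂) (hJ : JoinedLE G K₁ K₂ b₁ b₂) (hθ : θ₁.Le θ₂) (ω : Sample G)
    (s : ℝ) : CoupledLE G K₁ K₂ (step G K₁ b₁ θ₁ ω ξ₁ s) (step G K₂ b₂ θ₂ ω ξ₂ s) := by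
  refine ⟨fun e => ?_, fun e h1 h2 => ?_, fun e h2 h1 => ?_⟩
  · by_cases h1 : e ∈ edgesIn G K₁ <;> by_cases h2 : e ∈ edgesIn G K₂
    · by_cases hk : ∃ k, clockTime ω e k = s
      · simp only [RandomCluster.step, h1, h2, hk, and_self, if_true]
        rw [Bool.le_iff_imp]
        simp only [decide_eq_true_eq]
        rintro ⟨k, hk, hlt⟩
        exact ⟨k, hk, hlt.trans_le (openProb_mono hθ (hJ _ _ h.le e h1 h2))⟩
      · simp only [RandomCluster.step, hk, and_false, if_false]
        exact h.le e
    · rw [step_apply_of_notMem (ξ := ξ₂) h2, h.upper e h1 h2]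
      exact Bool.le_true _
    · rw [step_apply_of_notMem (ξ := ξ₁) h1, h.lower e h2 h1]
      exact Bool.false_le _
    · rw [step_apply_of_notMem h1, step_apply_of_notMem h2]
      exact h.le e
  · rw [step_apply_of_notMem h2, h.upper e h1 h2]
  · rw [step_apply_of_notMem h1, h.lower e h2 h1]

lemma CoupledLE.run {K₁ K₂ : Finset V} {b₁ b₂ : BC} {θ₁ θ₂ : Param} {ξ₁ ξ₂ : Config G}
    (h : CoupledLE G K₁ K₂ ξ₁ ξ₂) (hJ : JoinedLE G K₁ K₂ b₁ b₂) (hθ : θ₁.Le θ₂) {ω : Sample G}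
    (hω : Nonexplosive ω) (hK : K₁ ⊆ K₂ ∨ K₂ ⊆ K₁) (T : ℝ) :
    CoupledLE G K₁ K₂ (run G K₁ b₁ θ₁ ω T ξ₁) (run G K₂ b₂ θ₂ ω T ξ₂) := by
  rcases hK with hK | hK
  · rw [run_eq_foldl_of_subset hω hK b₁]
    exact foldl_rel (fun _ _ _ h => h.step hJ hθ ω _) _ h
  · rw [run_eq_foldl_of_subset hω hK b₂]
    exact foldl_rel (fun _ _ _ h => h.step hJ hθ ω _) _ h

lemma CoupledLE.of_le {K : Finset V} {ξ₁ ξ₂ : Config G} (h : ξ₁ ≤ ξ₂) :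
    CoupledLE G K K ξ₁ ξ₂ :=
  ⟨h, fun _ h1 h2 => absurd h1 h2, fun _ h1 h2 => absurd h1 h2⟩

lemma JoinedLE.self (K : Finset V) (b : BC) : JoinedLE G K K b b :=
  fun _ _ h _ he _ hJ => hJ.mono (fun f _ => h f) he

lemma JoinedLE.free {K K' : Finset V} (hK : K ⊆ K') (b : BC) : JoinedLE G K K' .free b :=
  fun _ _ h _ _ _ hJ => hJ.of_free hK (fun f _ => h f) b

lemma JoinedLE.wired {K K' : Finset V} (hK : K ⊆ K') : JoinedLE G K' K .wired .wired :=
  fun _ _ h _ _ he hJ => hJ.wired_anti hK (fun f _ => h f) he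

lemma chain_self_mono {ω : Sample G} (hω : Nonexplosive ω) (K : Finset V) (b : BC)
    {θ₁ θ₂ : Param} (hθ : θ₁.Le θ₂) (T : ℝ) :
    chain G K b θ₁ ω T 0 ≤ chain G K b θ₂ ω T 0 := by
  rw [chain_eq_run, chain_eq_run]
  exact ((CoupledLE.of_le le_rfl).run (.self K b) hθ hω (.inl subset_rfl) T).le

lemma chain_free_le {ω : Sample G} (hω : Nonexplosive ω) {K K' : Finset V} (hK : K ⊆ K')
    {θ₁ θ₂ : Param} (hθ : θ₁.Le θ₂) (T : ℝ) :
    chain G K .free θ₁ ω T 0 ≤ chain G K' .free θ₂ ω T 0 := by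
  rw [chain_eq_run, chain_eq_run]
  refine (CoupledLE.run ⟨le_rfl, fun e h1 h2 => ?_, fun _ _ _ => rfl⟩
    (.free hK .free) hθ hω (.inl hK) T).le
  exact absurd (edgesIn_mono hK h1) h2

lemma chain_wired_le {ω : Sample G} (hω : Nonexplosive ω) {K K' : Finset V} (hK : K ⊆ K')
    {θ₁ θ₂ : Param} (hθ : θ₁.Le θ₂) (T : ℝ) :
    chain G K' .wired θ₁ ω T 0 ≤ chain G K .wired θ₂ ω T 0 := by
  rw [chain_eq_run, chain_eq_run]
  refine (CoupledLE.run ⟨le_rfl, fun _ _ _ => rfl, fun e h1 h2 => ?_⟩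
    (.wired hK) hθ hω (.inr hK) T).le
  exact absurd (edgesIn_mono hK h1) h2

lemma chain_free_le_wired {ω : Sample G} (hω : Nonexplosive ω) (K : Finset V)
    {θ₁ θ₂ : Param} (hθ : θ₁.Le θ₂) (T : ℝ) :
    chain G K .free θ₁ ω T 0 ≤ chain G K .wired θ₂ ω T 0 := by
  rw [chain_eq_run, chain_eq_run]
  exact ((CoupledLE.of_le (fun _ => Bool.false_le _)).run (.free subset_rfl _) hθ hω
    (.inl subset_rfl) T).le

/-- At time `-T` the chain started earlier is in some state above all-closed; from then on both
chains use the same updates. -/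
lemma chain_free_mono_time {ω : Sample G} (hω : Nonexplosive ω) (K : Finset V) (θ : Param) :
    Monotone fun T => chain G K .free θ ω T 0 := by
  intro T T' h
  obtain ⟨ξ', h1⟩ := run_add hω K .free θ h (fun _ => BC.free.state)
  simp only [chain_eq_run]
  rw [h1]
  exact ((CoupledLE.of_le (fun _ => Bool.false_le _)).run (.self K _) (.refl θ) hω
    (.inl subset_rfl) T).le

lemma chain_wired_anti_time {ω : Sample G} (hω : Nonexplosive ω) (K : Finset V) (θ : Param) :
    Antitone fun T => chain G K .wired θ ω T 0 := by
  intro T T' h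
  obtain ⟨ξ', h1⟩ := run_add hω K .wired θ h (fun _ => BC.wired.state)
  simp only [chain_eq_run]
  rw [h1]
  exact ((CoupledLE.of_le (fun _ => Bool.le_true _)).run (.self K _) (.refl θ) hω
    (.inl subset_rfl) T).le

/-! ### Existence and order of the limits -/

lemma tendsto_limUnder_iff_eventually {ι : Type*} {l : Filter ι} {f : ι → Bool} :
    Tendsto f l (𝓝 (limUnder l f)) ↔ ∀ᶠ i in l, f i = limUnder l f := by
  rw [nhds_discrete, tendsto_pure]

lemma eventually_eq_limUnder_of_monotone {ι : Type*} [Preorder ι] [Nonempty ι]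
    [IsDirectedOrder ι] {f : ι → Bool} (hf : Monotone f) :
    ∀ᶠ i in atTop, f i = limUnder atTop f := by
  rw [← tendsto_limUnder_iff_eventually]
  refine tendsto_nhds_limUnder ?_
  by_cases h : ∃ i, f i = true
  · obtain ⟨i, hi⟩ := h
    refine ⟨true, ?_⟩
    rw [nhds_discrete, tendsto_pure]
    filter_upwards [eventually_ge_atTop i] with j hj
    have := hf hj
    rw [hi] at this
    exact Bool.le_iff_imp.1 this rfl
  · refine ⟨false, ?_⟩
    rw [nhds_discrete, tendsto_pure]
    exact Eventually.of_forall fun j => by simpa using fun hj => h ⟨j, hj⟩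

lemma eventually_eq_limUnder_of_antitone {ι : Type*} [Preorder ι] [Nonempty ι]
    [IsDirectedOrder ι] {f : ι → Bool} (hf : Antitone f) :
    ∀ᶠ i in atTop, f i = limUnder atTop f := by
  rw [← tendsto_limUnder_iff_eventually]
  refine tendsto_nhds_limUnder ?_
  by_cases h : ∃ i, f i = false
  · obtain ⟨i, hi⟩ := h
    refine ⟨false, ?_⟩
    rw [nhds_discrete, tendsto_pure]
    filter_upwards [eventually_ge_atTop i] with j hj
    have := hf hj
    rw [hi] at this
    exact le_antisymm this (Bool.false_le _)
  · refine ⟨true, ?_⟩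
    rw [nhds_discrete, tendsto_pure]
    exact Eventually.of_forall fun j => by simpa using fun hj => h ⟨j, hj⟩

lemma eventually_chain_eq_finiteX {ω : Sample G} (hω : Nonexplosive ω) (K : Finset V) (b : BC)
    (θ : Param) (e : G.edgeSet) :
    ∀ᶠ T : ℝ in atTop, chain G K b θ ω T 0 e = finiteX G K b θ ω e := by
  cases b
  · exact eventually_eq_limUnder_of_monotone
      fun _ _ h => chain_free_mono_time hω K θ h e
  · exact eventually_eq_limUnder_of_antitone
      fun _ _ h => chain_wired_anti_time hω K θ h e

lemma finiteX_le_of_chain_le {ω : Sample G} (hω : Nonexplosive ω) {K₁ K₂ : Finset V} {b₁ b₂ : BC}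
    {θ₁ θ₂ : Param} (h : ∀ T, chain G K₁ b₁ θ₁ ω T 0 ≤ chain G K₂ b₂ θ₂ ω T 0) :
    finiteX G K₁ b₁ θ₁ ω ≤ finiteX G K₂ b₂ θ₂ ω := by
  intro e
  obtain ⟨T, h1, h2⟩ := ((eventually_chain_eq_finiteX hω K₁ b₁ θ₁ e).and
    (eventually_chain_eq_finiteX hω K₂ b₂ θ₂ e)).exists
  rw [← h1, ← h2]
  exact h T e

lemma eventually_finiteX_eq_infiniteX {ω : Sample G} (hω : Nonexplosive ω) {W : ℕ → Finset V}
    (hW : Monotone W) (b : BC) (θ : Param) (e : G.edgeSet) :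
    ∀ᶠ i in atTop, finiteX G (W i) b θ ω e = infiniteX G W b θ ω e := by
  cases b
  · exact eventually_eq_limUnder_of_monotone fun _ _ h =>
      finiteX_le_of_chain_le hω (chain_free_le hω (hW h) (.refl θ)) e
  · exact eventually_eq_limUnder_of_antitone fun _ _ h =>
      finiteX_le_of_chain_le hω (chain_wired_le hω (hW h) (.refl θ)) e

lemma infiniteX_le_of_finiteX_le {ω : Sample G} (hω : Nonexplosive ω) {W : ℕ → Finset V}
    (hW : Monotone W) {b₁ b₂ : BC} {θ₁ θ₂ : Param}
    (h : ∀ i, finiteX G (W i) b₁ θ₁ ω ≤ finiteX G (W i) b₂ θ₂ ω) :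
    infiniteX G W b₁ θ₁ ω ≤ infiniteX G W b₂ θ₂ ω := by
  intro e
  obtain ⟨i, h1, h2⟩ := ((eventually_finiteX_eq_infiniteX hω hW b₁ θ₁ e).and
    (eventually_finiteX_eq_infiniteX hω hW b₂ θ₂ e)).exists
  rw [← h1, ← h2]
  exact h i e

lemma IsExhaustion.eventually_subset {W : ℕ → Finset V} (hW : IsExhaustion W) (K : Finset V) :
    ∀ᶠ i in atTop, K ⊆ W i := by
  have : ∀ᶠ i in atTop, ∀ x ∈ K, x ∈ W i := by
    rw [Filter.eventually_all_finset]
    intro x _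
    obtain ⟨i, hi⟩ := hW.cover x
    filter_upwards [eventually_ge_atTop i] with j hj using hW.mono hj hi
  exact this

lemma finiteX_free_le_infiniteX {ω : Sample G} (hω : Nonexplosive ω) {W : ℕ → Finset V}
    (hW : IsExhaustion W) (θ : Param) {K : Finset V} :
    finiteX G K .free θ ω ≤ infiniteX G W .free θ ω := by
  intro e
  obtain ⟨i, h1, h2⟩ := ((eventually_finiteX_eq_infiniteX hω hW.mono .free θ e).and
    (hW.eventually_subset K)).exists
  rw [← h1]
  exact finiteX_le_of_chain_le hω (chain_free_le hω h2 (.refl θ)) e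

lemma infiniteX_le_finiteX_wired {ω : Sample G} (hω : Nonexplosive ω) {W : ℕ → Finset V}
    (hW : IsExhaustion W) (θ : Param) {K : Finset V} :
    infiniteX G W .wired θ ω ≤ finiteX G K .wired θ ω := by
  intro e
  obtain ⟨i, h1, h2⟩ := ((eventually_finiteX_eq_infiniteX hω hW.mono .wired θ e).and
    (hW.eventually_subset K)).exists
  rw [← h1]
  exact finiteX_le_of_chain_le hω (chain_wired_le hω h2 (.refl θ)) e

/-- Every volume of one exhaustion is contained in late volumes of the other, so the two monotone
limits bound each other. -/
lemma infiniteX_eq_of_exhaustions {ω : Sample G} (hω : Nonexplosive ω) {W W' : ℕ → Finset V}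
    (hW : IsExhaustion W) (hW' : IsExhaustion W') (b : BC) (θ : Param) :
    infiniteX G W b θ ω = infiniteX G W' b θ ω := by
  have key : ∀ {W W' : ℕ → Finset V}, IsExhaustion W → IsExhaustion W' →
      infiniteX G W b θ ω ≤ infiniteX G W' b θ ω := by
    intro W W' hW hW' e
    cases b
    · obtain ⟨i, hi⟩ := (eventually_finiteX_eq_infiniteX hω hW.mono .free θ e).exists
      rw [← hi]
      exact finiteX_free_le_infiniteX hω hW' θ e
    · obtain ⟨i, hi⟩ := (eventually_finiteX_eq_infiniteX hω hW'.mono .wired θ e).exists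
      rw [← hi]
      exact infiniteX_le_finiteX_wired hω hW θ e
  exact le_antisymm (key hW hW') (key hW' hW)

end Coupling

/-! ### Effect of one edge on the cluster count, and detailed balance. -/

section ClusterCount

/-! ### Counting clusters -/

section Counting

variable {α : Type*}

/-- The number of components of `H` that do not meet `B`. -/
def countAvoiding (H : SimpleGraph α) (B : Set α) : ℕ :=
  Nat.card {c : H.ConnectedComponent // ∀ x ∈ B, H.connectedComponentMk x ≠ c}

/-- The two-colourings that are constant on the components of `H` and vanish on `B`. -/
def colorings (H : SimpleGraph α) (B : Set α) : Set (α → Bool) :=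
  {f | (∀ x y, H.Adj x y → f x = f y) ∧ ∀ x ∈ B, f x = false}

lemma colorings_eq_of_reachable {H : SimpleGraph α} {B : Set α} {f : α → Bool}
    (hf : f ∈ colorings H B) {x y : α} (h : H.Reachable x y) : f x = f y := by
  rw [SimpleGraph.reachable_iff_reflTransGen] at h
  induction h with
  | refl => rfl
  | tail _ hbc ih => exact ih.trans (hf.1 _ _ hbc)

open Classical in
/-- The colouring with prescribed values on the components that do not meet `B`. -/
def coloringOfComponents (H : SimpleGraph α) (B : Set α)
    (g : {c : H.ConnectedComponent // ∀ x ∈ B, H.connectedComponentMk x ≠ c} → Bool) :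
    colorings H B :=
  ⟨fun x => if h : ∀ z ∈ B, H.connectedComponentMk z ≠ H.connectedComponentMk x then
      g ⟨H.connectedComponentMk x, h⟩ else false, by
    constructor
    · intro x y hxy
      have : H.connectedComponentMk x = H.connectedComponentMk y :=
        SimpleGraph.ConnectedComponent.sound hxy.reachable
      simp only [this]
    · intro x hx
      exact dif_neg fun h => h x hx rfl⟩

lemma coloringOfComponents_bijective (H : SimpleGraph α) (B : Set α) :
    Function.Bijective (coloringOfComponents H B) := by
  constructor
  · intro g g' h
    funext ⟨c, hc⟩
    induction c using SimpleGraph.ConnectedComponent.ind with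
    | h x =>
      have := congrFun (congrArg Subtype.val h) x
      simp only [coloringOfComponents] at this
      rwa [dif_pos hc, dif_pos hc] at this
  · rintro ⟨f, hf⟩
    refine ⟨fun c => f c.1.out, Subtype.ext (funext fun x => ?_)⟩
    have hout : H.Reachable (H.connectedComponentMk x).out x :=
      SimpleGraph.ConnectedComponent.exact (Quot.out_eq _)
    simp only [coloringOfComponents]
    split_ifs with h
    · exact colorings_eq_of_reachable hf hout
    · push Not at h
      obtain ⟨z, hz, hzx⟩ := h
      rw [← colorings_eq_of_reachable hf (SimpleGraph.ConnectedComponent.exact hzx), hf.2 z hz]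

/-- Colourings turn component counts into cardinalities on which adding an edge is just the
constraint `f x = f y`; injectivity of `2 ^ ·` recovers the counts. -/
lemma card_colorings [Finite α] (H : SimpleGraph α) (B : Set α) :
    Nat.card (colorings H B) = 2 ^ countAvoiding H B := by
  rw [← Nat.card_congr (Equiv.ofBijective _ (coloringOfComponents_bijective H B)), Nat.card_fun]
  simp [countAvoiding]

/-- `H'` arises from `H` by adding the edge between `x` and `y`. -/
def IsAddEdge (H H' : SimpleGraph α) (x y : α) : Prop :=
  ∀ a b, H'.Adj a b ↔ H.Adj a b ∨ (a = x ∧ b = y) ∨ (a = y ∧ b = x)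

/-- `x` and `y` are connected in `H`, possibly through `B`. -/
def JoinedIn (H : SimpleGraph α) (B : Set α) (x y : α) : Prop :=
  H.Reachable x y ∨ (∃ u ∈ B, H.Reachable x u) ∧ ∃ v ∈ B, H.Reachable y v

lemma IsAddEdge.mem_colorings {H H' : SimpleGraph α} {x y : α} (h : IsAddEdge H H' x y)
    (B : Set α) (f : α → Bool) :
    f ∈ colorings H' B ↔ f ∈ colorings H B ∧ f x = f y := by
  constructor
  · rintro ⟨h1, h2⟩
    exact ⟨⟨fun a b hab => h1 a b ((h a b).2 (.inl hab)), h2⟩,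
      h1 x y ((h x y).2 (.inr (.inl ⟨rfl, rfl⟩)))⟩
  · rintro ⟨⟨h1, h2⟩, hxy⟩
    refine ⟨fun a b hab => ?_, h2⟩
    rcases (h a b).1 hab with hab | ⟨rfl, rfl⟩ | ⟨rfl, rfl⟩
    · exact h1 a b hab
    · exact hxy
    · exact hxy.symm

lemma IsAddEdge.countAvoiding_of_joinedIn [Finite α] {H H' : SimpleGraph α} {x y : α}
    (h : IsAddEdge H H' x y) {B : Set α} (hJ : JoinedIn H B x y) :
    countAvoiding H' B = countAvoiding H B := by
  have : colorings H' B = colorings H B := by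
    ext f
    rw [h.mem_colorings]
    refine and_iff_left_of_imp fun hf => ?_
    rcases hJ with hr | ⟨⟨u, hu, hxu⟩, v, hv, hyv⟩
    · exact colorings_eq_of_reachable hf hr
    · rw [colorings_eq_of_reachable hf hxu, colorings_eq_of_reachable hf hyv, hf.2 u hu,
        hf.2 v hv]
  have h2 := card_colorings H' B
  rw [this, card_colorings] at h2
  exact (Nat.pow_right_injective le_rfl h2).symm

open Classical in
-- Flip the colour on the component of `x`. This stays a colouring because the component avoids `B`,
-- and it toggles `f x = f y` because `y` lies outside.
lemma card_colorings_half [Finite α] {H : SimpleGraph α} {B : Set α} {x y : α}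
    (hx : ∀ u ∈ B, ¬ H.Reachable x u) (hxy : ¬ H.Reachable x y) :
    Nat.card {f : colorings H B // f.1 x = f.1 y} =
      Nat.card {f : colorings H B // ¬ f.1 x = f.1 y} := by
  let flip : (α → Bool) → α → Bool := fun f z => if H.Reachable x z then !f z else f z
  have flip_mem : ∀ f ∈ colorings H B, flip f ∈ colorings H B := by
    rintro f hf
    refine ⟨fun a b hab => ?_, fun z hz => ?_⟩
    · have : H.Reachable x a ↔ H.Reachable x b :=
        ⟨fun h => h.trans hab.reachable, fun h => h.trans hab.reachable.symm⟩
      simp only [flip, this, hf.1 a b hab]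
    · simp only [flip, hx z hz, if_false, hf.2 z hz]
  have flip_flip : ∀ f, flip (flip f) = f := by
    intro f
    funext z
    by_cases hz : H.Reachable x z <;> simp [flip, hz]
  have flip_x : ∀ f, flip f x = !f x := fun f => by simp [flip]
  have flip_y : ∀ f, flip f y = f y := fun f => by simp [flip, hxy]
  refine Nat.card_congr
    { toFun := fun f => ⟨⟨flip f.1.1, flip_mem _ f.1.2⟩, ?_⟩
      invFun := fun f => ⟨⟨flip f.1.1, flip_mem _ f.1.2⟩, ?_⟩
      left_inv := fun f => Subtype.ext (Subtype.ext (flip_flip _))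
      right_inv := fun f => Subtype.ext (Subtype.ext (flip_flip _)) }
  · have := f.2
    simp [flip_x, flip_y, this]
  · have := f.2
    simp only [flip_x, flip_y]
    revert this
    cases f.1.1 x <;> cases f.1.1 y <;> simp

lemma IsAddEdge.countAvoiding_of_not_joinedIn [Finite α] {H H' : SimpleGraph α} {x y : α}
    (h : IsAddEdge H H' x y) {B : Set α} (hJ : ¬ JoinedIn H B x y) :
    countAvoiding H B = countAvoiding H' B + 1 := by
  classical
  unfold JoinedIn at hJ
  push Not at hJ
  obtain ⟨hr, hB⟩ := hJ
  have half : Nat.card {f : colorings H B // f.1 x = f.1 y} =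
      Nat.card {f : colorings H B // ¬ f.1 x = f.1 y} := by
    -- At least one of the two components avoids `B`; that is the one to flip.
    by_cases hx : ∃ u ∈ B, H.Reachable x u
    · have := card_colorings_half (hB hx) (fun h => hr h.symm)
      simpa only [eq_comm] using this
    · push Not at hx
      exact card_colorings_half hx hr
  have e1 : Nat.card (colorings H' B) = Nat.card {f : colorings H B // f.1 x = f.1 y} :=
    Nat.card_congr
      { toFun := fun f => ⟨⟨f.1, ((h.mem_colorings B f.1).1 f.2).1⟩,
          ((h.mem_colorings B f.1).1 f.2).2⟩
        invFun := fun f => ⟨f.1.1, (h.mem_colorings B f.1.1).2 ⟨f.1.2, f.2⟩⟩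
        left_inv := fun _ => rfl
        right_inv := fun _ => rfl }
  have e2 : Nat.card (colorings H B) = Nat.card {f : colorings H B // f.1 x = f.1 y} +
      Nat.card {f : colorings H B // ¬ f.1 x = f.1 y} := by
    rw [← Nat.card_sum]
    exact Nat.card_congr (Equiv.sumCompl _).symm
  rw [← half, ← e1, card_colorings, card_colorings, ← two_mul, ← pow_succ'] at e2
  exact Nat.pow_right_injective le_rfl e2

end Counting

variable {V : Type*} {G : SimpleGraph V}

/-- The vertices of `K` that are wired together. -/
def wiredSet (G : SimpleGraph V) (K : Finset V) : BC → Set K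
  | .free => ∅
  | .wired => {x | (x : V) ∈ innerBoundary G K}

lemma clusterCount_eq (K : Finset V) (b : BC) (ξ : Config G) :
    clusterCount G K b ξ = countAvoiding (openGraph G K ξ) (wiredSet G K b) := by
  cases b
  · exact Nat.card_congr (Equiv.subtypeUnivEquiv (by simp [wiredSet])).symm
  · rfl

open Classical in
lemma joined_iff_joinedIn {K : Finset V} {b : BC} {ξ : Config G}
    {x y : K} (h : G.Adj x y) :
    Joined G K b ξ ⟨s((x : V), (y : V)), h⟩ ↔
      JoinedIn (openGraph G K (Function.update ξ ⟨s((x : V), (y : V)), h⟩ false))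
        (wiredSet G K b) x y := by
  have key : ∀ x' y' : K, (s((x : V), (y : V)) = s((x' : V), (y' : V))) →
      (x' = x ∧ y' = y) ∨ (x' = y ∧ y' = x) := by
    intro x' y' he
    rcases Sym2.eq_iff.1 he with ⟨h1, h2⟩ | ⟨h1, h2⟩
    · exact .inl ⟨Subtype.ext h1.symm, Subtype.ext h2.symm⟩
    · exact .inr ⟨Subtype.ext h2.symm, Subtype.ext h1.symm⟩
  unfold Joined JoinedIn
  constructor
  · rintro ⟨x', y', he, hJ⟩
    rcases key x' y' he with ⟨rfl, rfl⟩ | ⟨rfl, rfl⟩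
    · rcases hJ with hJ | ⟨rfl, h1, h2⟩
      · exact .inl hJ
      · exact .inr ⟨h1, h2⟩
    · rcases hJ with hJ | ⟨rfl, h1, h2⟩
      · exact .inl hJ.symm
      · exact .inr ⟨h2, h1⟩
  · intro hJ
    refine ⟨x, y, rfl, ?_⟩
    cases b
    · rcases hJ with hJ | ⟨⟨u, hu, -⟩, -⟩
      · exact .inl hJ
      · exact absurd hu (by simp [wiredSet])
    · rcases hJ with hJ | ⟨h1, h2⟩
      · exact .inl hJ
      · exact .inr ⟨rfl, h1, h2⟩

open Classical in
lemma isAddEdge_openGraph {K : Finset V} (ξ : Config G) {x y : K}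
    (h : G.Adj x y) :
    IsAddEdge (openGraph G K (Function.update ξ ⟨s((x : V), (y : V)), h⟩ false))
      (openGraph G K (Function.update ξ ⟨s((x : V), (y : V)), h⟩ true)) x y := by
  intro a b
  have key : ∀ hab : G.Adj a b, ((⟨s((a : V), (b : V)), hab⟩ : G.edgeSet) =
      ⟨s((x : V), (y : V)), h⟩) ↔ (a = x ∧ b = y) ∨ (a = y ∧ b = x) := by
    intro hab
    rw [Subtype.ext_iff, Subtype.ext_iff (a1 := a) (a2 := x), Subtype.ext_iff (a1 := a) (a2 := y),
      Subtype.ext_iff (a1 := b) (a2 := x), Subtype.ext_iff (a1 := b) (a2 := y)]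
    exact Sym2.eq_iff
  constructor
  · rintro ⟨hab, hopen⟩
    by_cases he : (⟨s((a : V), (b : V)), hab⟩ : G.edgeSet) = ⟨s((x : V), (y : V)), h⟩
    · exact .inr ((key hab).1 he)
    · refine .inl ⟨hab, ?_⟩
      rwa [Function.update_of_ne he] at hopen ⊢
  · rintro (⟨hab, hopen⟩ | hab)
    · refine ⟨hab, ?_⟩
      by_cases he : (⟨s((a : V), (b : V)), hab⟩ : G.edgeSet) = ⟨s((x : V), (y : V)), h⟩
      · rw [he, Function.update_self]
      · rwa [Function.update_of_ne he] at hopen ⊢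
    · have hadj : G.Adj a b := by
        rcases hab with ⟨rfl, rfl⟩ | ⟨rfl, rfl⟩
        · exact h
        · exact h.symm
      refine ⟨hadj, ?_⟩
      rw [(key hadj).2 hab, Function.update_self]

lemma exists_eq_mk_of_mem_edgesIn {K : Finset V} {e : G.edgeSet} (he : e ∈ edgesIn G K) :
    ∃ (x y : K) (h : G.Adj x y), e = ⟨s((x : V), (y : V)), h⟩ := by
  obtain ⟨e, hadj⟩ := e
  induction e using Sym2.ind with
  | _ x y =>
    rw [mk_mem_edgesIn] at he
    exact ⟨⟨x, he.1⟩, ⟨y, he.2⟩, hadj, rfl⟩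

open Classical in
lemma clusterCount_update {K : Finset V} (b : BC) (ξ : Config G)
    {e : G.edgeSet} (he : e ∈ edgesIn G K) :
    (Joined G K b ξ e → clusterCount G K b (Function.update ξ e true) =
      clusterCount G K b (Function.update ξ e false)) ∧
    (¬ Joined G K b ξ e → clusterCount G K b (Function.update ξ e false) =
      clusterCount G K b (Function.update ξ e true) + 1) := by
  obtain ⟨x, y, h, rfl⟩ := exists_eq_mk_of_mem_edgesIn he
  rw [joined_iff_joinedIn, clusterCount_eq, clusterCount_eq]
  exact ⟨(isAddEdge_openGraph ξ h).countAvoiding_of_joinedIn,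
    (isAddEdge_openGraph ξ h).countAvoiding_of_not_joinedIn⟩

open Classical in
-- `Joined` closes `e` before testing the connection, so the state of `e` is irrelevant.
lemma openProb_update (K : Finset V) (b : BC) (θ : Param) (ξ : Config G)
    (e : G.edgeSet) (v : Bool) :
    openProb G K b θ (Function.update ξ e v) e = openProb G K b θ ξ e := by
  have : Joined G K b (Function.update ξ e v) e ↔ Joined G K b ξ e := by
    simp only [Joined, Function.update_idem]
  simp only [openProb, this]

open Classical in
/-- Detailed balance for the heat-bath update of an edge. -/
lemma weight_update {K : Finset V} (b : BC) (θ : Param) (ξ : Config G)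
    {e : G.edgeSet} (he : e ∈ edgesIn G K) :
    (1 - openProb G K b θ ξ e) * weight G K b θ (Function.update ξ e true) =
      openProb G K b θ ξ e * weight G K b θ (Function.update ξ e false) := by
  have prod_eq : ∀ v : Bool,
      (∏ f ∈ edgesIn G K, if Function.update ξ e v f = true then θ.p else 1 - θ.p) =
      (if v = true then θ.p else 1 - θ.p) *
        ∏ f ∈ (edgesIn G K).erase e, if ξ f = true then θ.p else 1 - θ.p := by
    intro v
    rw [← Finset.mul_prod_erase _ _ he, Function.update_self]
    congr 1
    refine Finset.prod_congr rfl fun f hf => ?_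
    rw [Function.update_of_ne (Finset.ne_of_mem_erase hf)]
  unfold weight
  rw [prod_eq, prod_eq]
  obtain ⟨h1, h2⟩ := clusterCount_update b ξ he
  have hd := θ.denom_pos.ne'
  rw [if_pos rfl, if_neg Bool.false_ne_true]
  by_cases hJ : Joined G K b ξ e
  · rw [h1 hJ, openProb, if_pos hJ]
    ring
  -- The extra cluster of the closed configuration gives a factor `q`, matching `1 - low = (1-p)q /
  -- (p+(1-p)q)`.
  · rw [h2 hJ, pow_succ, openProb, if_neg hJ]
    field_simp
    ring

end ClusterCount

/-! ### Product measures and almost sure regularity of the clocks. -/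

section Randomness

/-! ### Infinite product measures -/

section Product

variable {ι α β : Type*} [MeasurableSpace α] [MeasurableSpace β]

lemma measurable_update_prod [DecidableEq ι] (i : ι) :
    Measurable (fun z : (ι → α) × α => Function.update z.1 i z.2) := by
  rw [measurable_pi_iff]
  intro j
  by_cases hj : j = i
  · subst hj
    simpa using measurable_snd
  · simp only [Function.update_of_ne hj]
    exact (measurable_pi_apply j).comp measurable_fst

/-- Resampling one coordinate does not change a product measure. -/
lemma infinitePi_map_update [DecidableEq ι] (μ : Measure α) [IsProbabilityMeasure μ] (i : ι) :
    ((Measure.infinitePi fun _ : ι => μ).prod μ).map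
      (fun z : (ι → α) × α => Function.update z.1 i z.2) = Measure.infinitePi fun _ : ι => μ := by
  refine Measure.eq_infinitePi _ fun s t ht => ?_
  rw [Measure.map_apply (measurable_update_prod i) (.pi s.countable_toSet fun _ _ => ht _)]
  by_cases hi : i ∈ s
  · have : (fun z : (ι → α) × α => Function.update z.1 i z.2) ⁻¹' ((s : Set ι).pi t) =
        (((s.erase i : Finset ι) : Set ι).pi t) ×ˢ (t i) := by
      ext z
      simp only [mem_preimage, Set.mem_pi, Finset.mem_coe, Set.mem_prod, Finset.mem_erase]
      constructor
      · intro h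
        refine ⟨fun j hj => ?_, by simpa using h i hi⟩
        simpa [Function.update_of_ne hj.1] using h j hj.2
      · rintro ⟨h1, h2⟩ j hj
        by_cases hji : j = i
        · subst hji
          simpa using h2
        · simpa [Function.update_of_ne hji] using h1 j ⟨hji, hj⟩
    rw [this, Measure.prod_prod, Measure.infinitePi_pi _ fun _ _ => ht _,
      Finset.prod_erase_mul _ _ hi]
  · have : (fun z : (ι → α) × α => Function.update z.1 i z.2) ⁻¹' ((s : Set ι).pi t) =
        ((s : Set ι).pi t) ×ˢ univ := by
      ext z
      simp only [mem_preimage, Set.mem_pi, Finset.mem_coe, Set.mem_prod, mem_univ, and_true]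
      refine forall₂_congr fun j hj => ?_
      rw [Function.update_of_ne (by rintro rfl; exact hi hj)]
    rw [this, Measure.prod_prod, Measure.infinitePi_pi _ fun _ _ => ht _, measure_univ, mul_one]

lemma lintegral_infinitePi_update [DecidableEq ι] (μ : Measure α) [IsProbabilityMeasure μ] (i : ι)
    {f : (ι → α) → ENNReal} (hf : Measurable f) :
    ∫⁻ x, f x ∂(Measure.infinitePi fun _ : ι => μ) =
      ∫⁻ x, ∫⁻ u, f (Function.update x i u) ∂μ ∂(Measure.infinitePi fun _ : ι => μ) := by
  conv_lhs => rw [← infinitePi_map_update μ i]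
  rw [lintegral_map hf (measurable_update_prod i), lintegral_prod]
  exact (hf.comp (measurable_update_prod i)).aemeasurable

/-- Pairing two independent families of independent variables. -/
def zip (z : (ι → α) × (ι → β)) : ι → α × β := fun i => (z.1 i, z.2 i)

lemma measurable_zip : Measurable (zip : (ι → α) × (ι → β) → ι → α × β) := by
  rw [measurable_pi_iff]
  intro i
  exact ((measurable_pi_apply i).comp measurable_fst).prodMk
    ((measurable_pi_apply i).comp measurable_snd)

/-- Separates clocks from marks, so that the clocks can be frozen. On a finite box, Fubini leaves
the integral of a product of functions of distinct independent coordinates. -/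
lemma infinitePi_prod (μ : Measure α) (ν : Measure β) [IsProbabilityMeasure μ]
    [IsProbabilityMeasure ν] :
    ((Measure.infinitePi fun _ : ι => μ).prod (Measure.infinitePi fun _ : ι => ν)).map zip =
      Measure.infinitePi fun _ : ι => μ.prod ν := by
  refine Measure.eq_infinitePi _ fun s t ht => ?_
  have hbox : MeasurableSet ((s : Set ι).pi t) := .pi s.countable_toSet fun _ _ => ht _
  rw [Measure.map_apply measurable_zip hbox, Measure.prod_apply (measurable_zip hbox)]
  have h1 : ∀ a : ι → α, (Measure.infinitePi fun _ : ι => ν) (Prod.mk a ⁻¹' (zip ⁻¹' (s : Set ι).pi t))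
      = ∏ i ∈ s, ν (Prod.mk (a i) ⁻¹' t i) := by
    intro a
    rw [← Measure.infinitePi_pi (fun _ : ι => ν) (t := fun i => Prod.mk (a i) ⁻¹' t i)
      fun i _ => measurable_prodMk_left (ht i)]
    rfl
  simp only [h1]
  have hm : ∀ i, Measurable fun x : α => ν (Prod.mk x ⁻¹' t i) := fun i =>
    measurable_measure_prodMk_left (ht i)
  have h2 := lintegral_prod_eq_prod_lintegral_of_indepFun (μ := Measure.infinitePi fun _ : ι => μ)
    s (fun i (a : ι → α) => ν (Prod.mk (a i) ⁻¹' t i))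
    (iIndepFun_infinitePi (P := fun _ : ι => μ) (X := fun i x => ν (Prod.mk x ⁻¹' t i)) hm)
    (fun i => (hm i).comp (measurable_pi_apply i))
  rw [h2]
  refine Finset.prod_congr rfl fun i _ => ?_
  rw [Measure.prod_apply (ht i), ← (measurePreserving_eval_infinitePi (fun _ : ι => μ) i).lintegral_comp
    (hm i)]

/-- Independent events of probability bounded below, each a box over its own set of coordinates,
occur infinitely often. -/
lemma ae_frequently_forall_mem (μ : Measure α) [IsProbabilityMeasure μ] {S : ℕ → Finset ι}
    (hS : Pairwise fun m n => Disjoint (S m) (S n)) {B : Set α} (hB : MeasurableSet B)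
    (hpos : μ B ≠ 0) {N : ℕ} (hN : ∀ m, (S m).card ≤ N) :
    ∀ᵐ x ∂(Measure.infinitePi fun _ : ι => μ), ∃ᶠ m in atTop, ∀ i ∈ S m, x i ∈ B := by
  classical
  set P := Measure.infinitePi fun _ : ι => μ
  set A : ℕ → Set (ι → α) := fun m => (S m : Set ι).pi fun _ => B
  have hA : ∀ m, MeasurableSet (A m) := fun m => .pi (S m).countable_toSet fun _ _ => hB
  have hPA : ∀ m, P (A m) = μ B ^ (S m).card := fun m => by
    rw [Measure.infinitePi_pi (fun _ : ι => μ) fun _ _ => hB, Finset.prod_const]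
  have hind : iIndepSet A P := by
    rw [iIndepSet_iff_meas_biInter hA]
    intro F
    have : ⋂ m ∈ F, A m = ((F.biUnion S : Finset ι) : Set ι).pi fun _ => B := by
      ext x
      simp only [A, mem_iInter, Set.mem_pi, Finset.mem_coe, Finset.mem_biUnion]
      exact ⟨fun h i ⟨m, hm, hi⟩ => h m hm i hi, fun h m hm i hi => h i ⟨m, hm, hi⟩⟩
    rw [this, Measure.infinitePi_pi (fun _ : ι => μ) fun _ _ => hB,
      Finset.prod_biUnion fun m _ n _ hmn => hS hmn]
    refine Finset.prod_congr rfl fun m _ => ?_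
    rw [hPA, Finset.prod_const]
  -- Each term is at least `μ B ^ N > 0`, so the second Borel–Cantelli lemma applies.
  have hsum : ∑' m, P (A m) = ⊤ := by
    rw [eq_top_iff, ← ENNReal.tsum_const_eq_top_of_ne_zero (α := ℕ) (pow_ne_zero N hpos)]
    refine ENNReal.tsum_le_tsum fun m => ?_
    rw [hPA]
    exact pow_le_pow_right_of_le_one' prob_le_one (hN m)
  have hlim := measure_limsup_eq_one hA hind hsum
  have hae : ∀ᵐ x ∂P, x ∈ limsup A atTop := by
    rw [← prob_compl_eq_zero_iff (MeasurableSet.measurableSet_limsup hA)] at hlim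
    exact hlim
  filter_upwards [hae] with x hx
  rw [mem_limsup_iff_frequently_mem] at hx
  exact hx

end Product

/-! ### Exponential clocks -/

instance : IsProbabilityMeasure (expMeasure 1) := isProbabilityMeasure_expMeasure one_pos

instance : NullSingletonClass (expMeasure 1) := by
  unfold expMeasure gammaMeasure
  infer_instance

lemma expMeasure_Iic (x : ℝ) (hx : 0 ≤ x) :
    expMeasure 1 (Iic x) = ENNReal.ofReal (1 - Real.exp (-x)) := by
  rw [← ofReal_cdf, cdf_expMeasure_eq one_pos, if_pos hx, one_mul]

lemma expMeasure_Ioi_ne_zero (x : ℝ) (hx : 0 ≤ x) : expMeasure 1 (Ioi x) ≠ 0 := by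
  rw [← compl_Iic, prob_compl_eq_one_sub measurableSet_Iic, expMeasure_Iic x hx]
  have : ENNReal.ofReal (1 - Real.exp (-x)) < 1 := by
    rw [ENNReal.ofReal_lt_one]
    linarith [Real.exp_pos (-x)]
  exact (tsub_pos_of_lt this).ne'

variable {V : Type*} {G : SimpleGraph V}

/-- The law of the waiting times. -/
def clockLaw (G : SimpleGraph V) : Measure (G.edgeSet × ℕ → ℝ) :=
  Measure.infinitePi fun _ : G.edgeSet × ℕ => expMeasure 1

/-- The law of one uniform variable. -/
def unifLaw : Measure ℝ := volume.restrict (Icc (0 : ℝ) 1)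

instance : IsProbabilityMeasure unifLaw := ⟨by simp [unifLaw]⟩

/-- The law of the uniform variables. -/
def markFieldLaw (G : SimpleGraph V) : Measure (G.edgeSet × ℕ → ℝ) :=
  Measure.infinitePi fun _ : G.edgeSet × ℕ => unifLaw

instance : IsProbabilityMeasure (clockLaw G) := by unfold clockLaw; infer_instance

instance : IsProbabilityMeasure (markFieldLaw G) := by unfold markFieldLaw; infer_instance

instance : IsProbabilityMeasure (sampleLaw G) := by unfold sampleLaw; infer_instance

lemma sampleLaw_eq_map_zip :
    sampleLaw G = ((clockLaw G).prod (markFieldLaw G)).map zip :=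
  (infinitePi_prod (ι := G.edgeSet × ℕ) (expMeasure 1) unifLaw).symm

/-- The samples for which the waiting times are positive, the clocks do not accumulate and no two
clocks ring simultaneously. -/
structure Good (ω : Sample G) : Prop where
  pos : ∀ i, 0 < (ω i).1
  nonexplosive : Nonexplosive ω
  injective : Function.Injective fun i : G.edgeSet × ℕ => clockTime ω i.1 i.2

lemma clockTime_strictMono {ω : Sample G} (h : ∀ i, 0 < (ω i).1) (e : G.edgeSet) :
    StrictMono (clockTime ω e) := by
  refine strictMono_nat_of_lt_succ fun k => ?_
  unfold clockTime
  rw [Finset.sum_range_succ _ (k + 1)]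
  exact lt_add_of_pos_right _ (h _)

lemma clockTime_pos {ω : Sample G} (h : ∀ i, 0 < (ω i).1) (e : G.edgeSet) (k : ℕ) :
    0 < clockTime ω e k :=
  Finset.sum_pos (fun _ _ => h _) ⟨0, by simp⟩

lemma Good.of_ne {ω : Sample G} (h1 : ∀ i, 0 < (ω i).1) (h2 : Nonexplosive ω)
    (h3 : ∀ e f k l, e ≠ f → clockTime ω e k ≠ clockTime ω f l) : Good ω := by
  refine ⟨h1, h2, ?_⟩
  rintro ⟨e, k⟩ ⟨f, l⟩ h
  by_cases hef : e = f
  · subst hef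
    have hkl : k = l := (clockTime_strictMono h1 e).injective h
    rw [hkl]
  · exact absurd h (h3 e f k l hef)

/-- Infinitely many waiting times above `1` prevent the terms from tending to `0`, so their sum
diverges. -/
lemma nonexplosive_of_frequently {ω : Sample G} (h1 : ∀ i, 0 < (ω i).1)
    (h2 : ∀ e, ∃ᶠ k in atTop, 1 < (ω (e, k)).1) : Nonexplosive ω := by
  intro e
  have h0 : ∀ k, 0 ≤ (ω (e, k)).1 := fun k => (h1 _).le
  have hns : ¬ Summable fun k => (ω (e, k)).1 := by
    intro hs
    have := hs.tendsto_atTop_zero.eventually (gt_mem_nhds one_pos)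
    obtain ⟨k, hk1, hk2⟩ := ((h2 e).and_eventually this).exists
    exact lt_asymm hk1 hk2
  -- The shift is due to `clockTime ω e k` having `k + 1` summands.
  exact ((not_summable_iff_tendsto_nat_atTop_of_nonneg h0).1 hns).comp (tendsto_add_atTop_nat 1)

lemma measurable_clockTime (e : G.edgeSet) (k : ℕ) :
    Measurable fun ω : Sample G => clockTime ω e k := by
  unfold clockTime
  fun_prop

open Classical in
lemma clockTime_update_self (φ U : G.edgeSet × ℕ → ℝ) (e : G.edgeSet) (k : ℕ) (u : ℝ) :
    clockTime (zip (Function.update φ (e, 0) u, U)) e k =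
      u + ∑ j ∈ Finset.range k, φ (e, j + 1) := by
  unfold clockTime
  rw [Finset.sum_range_succ', add_comm]
  congr 1
  · simp [zip]
  · refine Finset.sum_congr rfl fun j _ => ?_
    simp [zip]

open Classical in
lemma clockTime_update_of_ne (φ U : G.edgeSet × ℕ → ℝ) {e f : G.edgeSet} (hef : f ≠ e) (k : ℕ)
    (u : ℝ) :
    clockTime (zip (Function.update φ (e, 0) u, U)) f k = clockTime (zip (φ, U)) f k := by
  unfold clockTime
  refine Finset.sum_congr rfl fun j _ => ?_
  simp [zip, hef]

/-- Resample the first waiting time of `e`: it enters every ring time of `e` and none of `f`, so a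
coincidence pins it to one point, and the exponential law has no atoms. Ring times ignore the marks,
which are set to `0`. -/
lemma ae_clockLaw_ne {e f : G.edgeSet} (hef : e ≠ f) (k l : ℕ) :
    ∀ᵐ φ ∂clockLaw G, clockTime (zip (φ, fun _ => 0)) e k ≠ clockTime (zip (φ, fun _ => 0)) f l := by
  classical
  have hz : Measurable fun φ : G.edgeSet × ℕ → ℝ => zip (φ, fun _ : G.edgeSet × ℕ => (0 : ℝ)) :=
    measurable_zip.comp (measurable_id.prodMk measurable_const)
  have hm : MeasurableSet {φ : G.edgeSet × ℕ → ℝ |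
      clockTime (zip (φ, fun _ => 0)) e k = clockTime (zip (φ, fun _ => 0)) f l} :=
    measurableSet_eq_fun ((measurable_clockTime e k).comp hz) ((measurable_clockTime f l).comp hz)
  rw [ae_iff]
  simp only [not_not]
  rw [← lintegral_indicator_one hm, clockLaw,
    lintegral_infinitePi_update (expMeasure 1) (e, 0) (measurable_one.indicator hm)]
  refine (lintegral_congr fun φ => ?_).trans lintegral_zero
  have : ∀ u, ({φ : G.edgeSet × ℕ → ℝ | clockTime (zip (φ, fun _ => 0)) e k =
      clockTime (zip (φ, fun _ => 0)) f l}.indicator 1 (Function.update φ (e, 0) u) : ENNReal) =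
      ({clockTime (zip (φ, fun _ => 0)) f l - ∑ j ∈ Finset.range k, φ (e, j + 1)} :
        Set ℝ).indicator 1 u := by
    intro u
    simp only [Set.indicator, mem_ofPred_eq, clockTime_update_self,
      clockTime_update_of_ne _ _ hef.symm, mem_singleton_iff, eq_sub_iff_add_eq, Pi.one_apply]
  rw [lintegral_congr this, lintegral_indicator_one (measurableSet_singleton _), measure_singleton]

variable [Countable V]

instance : Countable G.edgeSet := by
  have : Countable (Sym2 V) := by unfold Sym2; infer_instance
  infer_instance

lemma ae_clockLaw_pos : ∀ᵐ φ ∂clockLaw G, ∀ i, 0 < φ i := by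
  rw [ae_all_iff]
  intro i
  have h : ∀ᵐ x ∂expMeasure 1, 0 < x := by
    have : expMeasure 1 (Iic 0) = 0 := by simp [expMeasure_Iic]
    rw [ae_iff]
    simpa [Iic] using this
  exact (measurePreserving_eval_infinitePi (fun _ : G.edgeSet × ℕ => expMeasure 1)
    i).quasiMeasurePreserving.ae h

lemma ae_clockLaw_frequently : ∀ᵐ φ ∂clockLaw G, ∀ e, ∃ᶠ k in atTop, 1 < φ (e, k) := by
  rw [ae_all_iff]
  intro e
  have := ae_frequently_forall_mem (ι := G.edgeSet × ℕ) (expMeasure 1) (S := fun k => {(e, k)})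
    (fun m n hmn => by simpa using hmn) measurableSet_Ioi
    (expMeasure_Ioi_ne_zero 1 zero_le_one) (N := 1) (fun _ => by simp)
  filter_upwards [this] with φ hφ
  simpa using hφ

/-- Goodness depends on the clocks alone, so one null set of `φ` serves all marks. -/
lemma ae_clockLaw_good : ∀ᵐ φ ∂clockLaw G, ∀ U, Good (zip (φ, U) : Sample G) := by
  have h3 : ∀ᵐ φ ∂clockLaw G, ∀ e f k l, e ≠ f →
      clockTime (zip (φ, fun _ => 0)) e k ≠ clockTime (zip (φ, fun _ => 0)) f l := by
    simp only [ae_all_iff]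
    intro e f k l hef
    exact ae_clockLaw_ne hef k l
  filter_upwards [ae_clockLaw_pos, ae_clockLaw_frequently, h3] with φ h1 h2 h3 U
  exact .of_ne h1 (nonexplosive_of_frequently h1 h2) h3

lemma measurableSet_good : MeasurableSet {ω : Sample G | Good ω} := by
  have : {ω : Sample G | Good ω} = {ω | ∀ i, 0 < (ω i).1} ∩
      {ω | ∀ e, ∀ N : ℕ, ∃ k, ∀ l ≥ k, (N : ℝ) ≤ clockTime ω e l} ∩
      {ω | ∀ i j : G.edgeSet × ℕ, i ≠ j → clockTime ω i.1 i.2 ≠ clockTime ω j.1 j.2} := by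
    ext ω
    have hn : Nonexplosive ω ↔ ∀ e, ∀ N : ℕ, ∃ k, ∀ l ≥ k, (N : ℝ) ≤ clockTime ω e l := by
      refine forall_congr' fun e => ?_
      rw [tendsto_atTop]
      constructor
      · intro h N
        exact eventually_atTop.1 (h N)
      · intro h x
        obtain ⟨N, hN⟩ := exists_nat_ge x
        filter_upwards [eventually_atTop.2 (h N)] with k hk using hN.trans hk
    constructor
    · rintro ⟨h1, h2, h3⟩
      exact ⟨⟨h1, hn.1 h2⟩, fun i j hij h => hij (h3 h)⟩
    · rintro ⟨⟨h1, h2⟩, h3⟩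
      exact ⟨h1, hn.2 h2, fun i j h => by_contra fun hij => h3 i j hij h⟩
  rw [this]
  refine (MeasurableSet.inter ?_ ?_).inter ?_
  · exact measurableSet_setOfPred.2 <| .forall fun i => measurableSet_setOfPred.1 <|
      measurableSet_lt measurable_const (by fun_prop)
  · exact measurableSet_setOfPred.2 <| .forall fun e => .forall fun N => .exists fun k =>
      .forall fun l => .forall fun _ => measurableSet_setOfPred.1 <|
        measurableSet_le measurable_const (measurable_clockTime e l)
  · exact measurableSet_setOfPred.2 <| .forall fun i => .forall fun j => .forall fun _ =>
      measurableSet_setOfPred.1 <|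
        (measurableSet_eq_fun (measurable_clockTime _ _) (measurable_clockTime _ _)).compl

lemma ae_good : ∀ᵐ ω ∂sampleLaw G, Good ω := by
  rw [sampleLaw_eq_map_zip, ae_map_iff measurable_zip.aemeasurable measurableSet_good]
  have := (Measure.quasiMeasurePreserving_fst (μ := clockLaw G) (ν := markFieldLaw G)).ae
    ae_clockLaw_good
  filter_upwards [this] with z hz using hz z.2

end Randomness

/-! ### Sequential form of the dynamics and measurability. -/

section Schedule

variable {V : Type*} {G : SimpleGraph V}

/-! ### Sequential description of the dynamics -/

open Classical in
/-- The heat-bath update of the edge `i.1`, using the mark with index `i`. -/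
def heatBath (G : SimpleGraph V) (K : Finset V) (b : BC) (θ : Param) (U : G.edgeSet × ℕ → ℝ)
    (ξ : Config G) (i : G.edgeSet × ℕ) : Config G :=
  Function.update ξ i.1 (decide (U i < openProb G K b θ ξ i.1))

/-- The list of all update events in `[0, T)`, in chronological order of the dynamics. -/
structure IsSchedule (K : Finset V) (ω : Sample G) (T : ℝ) (L : List (G.edgeSet × ℕ)) : Prop where
  mem_iff : ∀ i, i ∈ L ↔ i.1 ∈ edgesIn G K ∧ clockTime ω i.1 i.2 < T
  pairwise : L.Pairwise fun i j => clockTime ω i.1 i.2 > clockTime ω j.1 j.2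

lemma IsSchedule.nodup {K : Finset V} {ω : Sample G} {T : ℝ} {L : List (G.edgeSet × ℕ)}
    (h : IsSchedule K ω T L) : L.Nodup :=
  h.pairwise.imp fun {i j} hij => by
    rintro rfl
    exact lt_irrefl _ hij

/-- Ring times are distinct, so this time belongs to the single index `i`. -/
lemma Good.step_eq_heatBath {ω : Sample G} (hω : Good ω) {K : Finset V} (b : BC) (θ : Param)
    (ξ : Config G) {i : G.edgeSet × ℕ} (hi : i.1 ∈ edgesIn G K) :
    step G K b θ ω ξ (clockTime ω i.1 i.2) = heatBath G K b θ (fun j => (ω j).2) ξ i := by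
  classical
  obtain ⟨e, k⟩ := i
  have huniq : ∀ {f l}, clockTime ω f l = clockTime ω e k → f = e ∧ l = k := by
    intro f l h
    have := @hω.injective (f, l) (e, k) h
    exact Prod.mk.inj this
  funext f
  by_cases hf : f = e
  · subst hf
    simp only [step, heatBath, Function.update_self]
    rw [if_pos ⟨hi, k, rfl⟩]
    refine decide_eq_decide.2 ⟨?_, fun h => ⟨k, rfl, h⟩⟩
    rintro ⟨l, hl, h⟩
    rwa [(huniq hl).2] at h
  · simp only [step, heatBath, Function.update_of_ne hf]
    rw [if_neg]
    rintro ⟨-, l, hl⟩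
    exact hf (huniq hl).1

lemma IsSchedule.run_eq {K : Finset V} {ω : Sample G} {T : ℝ} {L : List (G.edgeSet × ℕ)}
    (h : IsSchedule K ω T L) (hω : Good ω) (b : BC) (θ : Param) (ξ : Config G) :
    run G K b θ ω T ξ = L.foldl (heatBath G K b θ fun j => (ω j).2) ξ := by
  have hs : (updateFinset G K ω T).sort (· ≥ ·) =
      L.map fun i => clockTime ω i.1 i.2 := by
    refine sort_ge_eq_of_pairwise (List.pairwise_map.2 h.pairwise) fun s => ?_
    rw [hω.nonexplosive.mem_updateFinset, List.mem_map]
    constructor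
    · rintro ⟨i, hi, rfl⟩
      obtain ⟨h1, h2⟩ := (h.mem_iff i).1 hi
      exact ⟨h2, (clockTime_pos hω.pos _ _).le, i.1, h1, i.2, rfl⟩
    · rintro ⟨h1, -, e, he, k, rfl⟩
      exact ⟨(e, k), (h.mem_iff _).2 ⟨he, h1⟩, rfl⟩
  unfold run
  rw [hs, List.foldl_map]
  exact List.foldl_ext _ _ _ fun ζ i hi => hω.step_eq_heatBath b θ ζ ((h.mem_iff i).1 hi).1

lemma Good.exists_isSchedule {ω : Sample G} (hω : Good ω) (K : Finset V) (T : ℝ) :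
    ∃ L, IsSchedule K ω T L := by
  have hmem : (updateFinset G K ω T).sort (· ≥ ·) ∈
      range (List.map fun i : G.edgeSet × ℕ => clockTime ω i.1 i.2) := by
    rw [range_list_map]
    intro s hs
    rw [Finset.mem_sort, hω.nonexplosive.mem_updateFinset] at hs
    obtain ⟨-, -, e, -, k, hk⟩ := hs
    exact ⟨(e, k), hk⟩
  obtain ⟨L, hL⟩ := hmem
  refine ⟨L, fun i => ?_, ?_⟩
  · have h1 : i ∈ L ↔ clockTime ω i.1 i.2 ∈ L.map fun i => clockTime ω i.1 i.2 :=
      (List.mem_map_of_injective hω.injective).symm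
    rw [h1, hL, Finset.mem_sort, hω.nonexplosive.mem_updateFinset]
    constructor
    · rintro ⟨h1, -, e, he, k, hk⟩
      have := @hω.injective (e, k) i hk
      rw [← this]
      exact ⟨he, by rwa [← this] at h1⟩
    · rintro ⟨h1, h2⟩
      exact ⟨h2, (clockTime_pos hω.pos _ _).le, i.1, h1, i.2, rfl⟩
  · have := sort_ge_pairwise (updateFinset G K ω T)
    rwa [← hL, List.pairwise_map] at this

/-! ### Measurability -/

lemma Joined.mem_edgesIn {K : Finset V} {b : BC} {ξ : Config G} {e : G.edgeSet}
    (h : Joined G K b ξ e) : e ∈ edgesIn G K := by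
  obtain ⟨x, y, he, -⟩ := h
  rw [RandomCluster.mem_edgesIn, he]
  simp

lemma joined_congr {K : Finset V} {b : BC} {ξ ξ' : Config G} {e : G.edgeSet}
    (h : ∀ f ∈ edgesIn G K, ξ f = ξ' f) : Joined G K b ξ e ↔ Joined G K b ξ' e :=
  ⟨fun hJ => hJ.mono (fun f hf => (h f hf).le) hJ.mem_edgesIn,
    fun hJ => hJ.mono (fun f hf => (h f hf).ge) hJ.mem_edgesIn⟩

lemma extend_apply_of_mem {K : Finset V} {b : BC} {η : edgesIn G K → Bool} {e : G.edgeSet}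
    (he : e ∈ edgesIn G K) : extend G K b η e = η ⟨e, he⟩ := by
  simp [extend, he]

lemma extend_apply_of_notMem {K : Finset V} {b : BC} {η : edgesIn G K → Bool} {e : G.edgeSet}
    (he : e ∉ edgesIn G K) : extend G K b η e = b.state := by
  simp [extend, he]

/-- The event depends only on the finitely many edges of `E(K)`. -/
lemma measurableSet_joined (K : Finset V) (b : BC) (e : G.edgeSet) :
    MeasurableSet {ξ : Config G | Joined G K b ξ e} := by
  have : {ξ : Config G | Joined G K b ξ e} =
      (fun (ξ : Config G) (f : edgesIn G K) => ξ f) ⁻¹' {η | Joined G K b (extend G K b η) e} := by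
    ext ξ
    exact joined_congr fun f hf => (extend_apply_of_mem (η := fun f : edgesIn G K => ξ f) hf).symm
  rw [this]
  exact (measurable_pi_lambda _ fun f => measurable_pi_apply _) (Set.toFinite _).measurableSet

lemma measurable_openProb (K : Finset V) (b : BC) (θ : Param) (e : G.edgeSet) :
    Measurable fun ξ : Config G => openProb G K b θ ξ e :=
  Measurable.ite (measurableSet_joined K b e) measurable_const measurable_const

lemma measurable_heatBath (K : Finset V) (b : BC) (θ : Param) (i : G.edgeSet × ℕ) :
    Measurable fun z : (G.edgeSet × ℕ → ℝ) × Config G => heatBath G K b θ z.1 z.2 i := by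
  classical
  rw [measurable_pi_iff]
  intro f
  by_cases hf : f = i.1
  · subst hf
    simp only [heatBath, Function.update_self]
    refine measurable_to_bool ?_
    have : (fun z : (G.edgeSet × ℕ → ℝ) × Config G =>
        decide (z.1 i < openProb G K b θ z.2 i.1)) ⁻¹' {true} =
        {z | z.1 i < openProb G K b θ z.2 i.1} := by
      ext z
      simp
    rw [this]
    exact measurableSet_lt ((measurable_pi_apply i).comp measurable_fst)
      ((measurable_openProb K b θ i.1).comp measurable_snd)
  · simp only [heatBath, Function.update_of_ne hf]
    exact (measurable_pi_apply f).comp measurable_snd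

lemma measurable_foldl_heatBath {Ω : Type*} [MeasurableSpace Ω] (K : Finset V) (b : BC)
    (θ : Param) (L : List (G.edgeSet × ℕ)) {U : Ω → G.edgeSet × ℕ → ℝ} (hU : Measurable U)
    {Y : Ω → Config G} (hY : Measurable Y) :
    Measurable fun x => L.foldl (heatBath G K b θ (U x)) (Y x) := by
  induction L generalizing Y with
  | nil => exact hY
  | cons i L ih => exact ih ((measurable_heatBath K b θ i).comp (hU.prodMk hY))

/-- A limit of eventually constant Boolean functions is measurable. -/
lemma measurable_of_eventually_eq {Ω : Type*} [MeasurableSpace Ω] {f : ℕ → Ω → Bool}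
    {g : Ω → Bool} (hf : ∀ n, Measurable (f n)) (h : ∀ x, ∀ᶠ n in atTop, f n x = g x) :
    Measurable g := by
  refine measurable_to_bool ?_
  have : g ⁻¹' {true} = {x | ∃ N, ∀ n, N ≤ n → f n x = true} := by
    ext x
    obtain ⟨N, hN⟩ := eventually_atTop.1 (h x)
    constructor
    · intro hx
      exact ⟨N, fun n hn => (hN n hn).trans hx⟩
    · rintro ⟨M, hM⟩
      have := hM (max M N) (le_max_left _ _)
      rw [hN _ (le_max_right _ _)] at this
      exact this
  rw [this]
  exact measurableSet_setOfPred.2 <| .exists fun N => .forall fun n => .imp measurable_const <|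
    (hf n).eq_const true

variable [Countable V]

lemma measurableSet_isSchedule (K : Finset V) (T : ℝ) (L : List (G.edgeSet × ℕ)) :
    MeasurableSet {ω : Sample G | IsSchedule K ω T L} := by
  have : {ω : Sample G | IsSchedule K ω T L} =
      {ω | ∀ i, i ∈ L ↔ i.1 ∈ edgesIn G K ∧ clockTime ω i.1 i.2 < T} ∩
      {ω | ∀ i j : Fin L.length, i < j →
        clockTime ω (L.get i).1 (L.get i).2 > clockTime ω (L.get j).1 (L.get j).2} := by
    ext ω
    exact ⟨fun ⟨h1, h2⟩ => ⟨h1, List.pairwise_iff_get.1 h2⟩,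
      fun ⟨h1, h2⟩ => ⟨h1, List.pairwise_iff_get.2 h2⟩⟩
  rw [this]
  refine MeasurableSet.inter ?_ ?_
  · exact measurableSet_setOfPred.2 <| .forall fun i => .iff measurable_const <|
      .and measurable_const <| measurableSet_setOfPred.1 <|
        measurableSet_lt (measurable_clockTime _ _) measurable_const
  · exact measurableSet_setOfPred.2 <| .forall fun i => .forall fun j => .imp measurable_const <|
      measurableSet_setOfPred.1 <|
        measurableSet_lt (measurable_clockTime _ _) (measurable_clockTime _ _)

/-- There are countably many possible schedules, and on each the run is a fixed finite composition
of measurable updates. -/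
lemma measurable_run_good (K : Finset V) (b : BC) (θ : Param) (T : ℝ) (ξ : Config G) :
    Measurable fun ω : {ω : Sample G // Good ω} => run G K b θ ω.1 T ξ := by
  rw [measurable_pi_iff]
  intro e
  refine measurable_to_bool ?_
  have : (fun ω : {ω : Sample G // Good ω} => run G K b θ ω.1 T ξ e) ⁻¹' {true} =
      ⋃ L : List (G.edgeSet × ℕ), {ω : {ω : Sample G // Good ω} | IsSchedule K ω.1 T L} ∩
        {ω | L.foldl (heatBath G K b θ fun j => (ω.1 j).2) ξ e = true} := by
    ext ω
    simp only [mem_preimage, mem_singleton_iff, mem_iUnion, mem_inter_iff, mem_ofPred_eq]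
    constructor
    · intro h
      obtain ⟨L, hL⟩ := ω.2.exists_isSchedule K T
      refine ⟨L, hL, ?_⟩
      rwa [← hL.run_eq ω.2]
    · rintro ⟨L, hL, h⟩
      rwa [hL.run_eq ω.2]
  rw [this]
  refine MeasurableSet.iUnion fun L => MeasurableSet.inter ?_ ?_
  · exact measurable_subtype_coe (measurableSet_isSchedule K T L)
  · have hU : Measurable fun ω : {ω : Sample G // Good ω} => fun j => (ω.1 j).2 :=
      measurable_pi_lambda _ fun j =>
        measurable_snd.comp ((measurable_pi_apply j).comp measurable_subtype_coe)
    have := measurable_foldl_heatBath K b θ L hU (measurable_const (a := ξ))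
    exact ((measurable_pi_apply e).comp this) (measurableSet_singleton true)

lemma measurable_finiteX_good (K : Finset V) (b : BC) (θ : Param) :
    Measurable fun ω : {ω : Sample G // Good ω} => finiteX G K b θ ω.1 := by
  rw [measurable_pi_iff]
  intro e
  refine measurable_of_eventually_eq (f := fun n (ω : {ω : Sample G // Good ω}) =>
    run G K b θ ω.1 n (fun _ => b.state) e) (fun n => ?_) fun ω => ?_
  · exact (measurable_pi_apply e).comp (measurable_run_good K b θ n _)
  · have := (eventually_chain_eq_finiteX ω.2.nonexplosive K b θ e)
    simp only [chain_eq_run] at this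
    exact tendsto_natCast_atTop_atTop.eventually this

lemma measurable_infiniteX_good {W : ℕ → Finset V} (hW : Monotone W) (b : BC) (θ : Param) :
    Measurable fun ω : {ω : Sample G // Good ω} => infiniteX G W b θ ω.1 := by
  rw [measurable_pi_iff]
  intro e
  exact measurable_of_eventually_eq
    (fun i => (measurable_pi_apply e).comp (measurable_finiteX_good (W i) b θ))
    fun ω => eventually_finiteX_eq_infiniteX ω.2.nonexplosive hW b θ e

lemma measurable_jointX_good {W : ℕ → Finset V} (hW : Monotone W) :
    Measurable fun ω : {ω : Sample G // Good ω} => jointX G W ω.1 :=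
  measurable_pi_lambda _ fun a => measurable_infiniteX_good hW a.1 a.2

/-- The exceptional set does not depend on `f`, so this also covers the joint family over
uncountably many parameters. -/
lemma aemeasurable_of_measurable_good {β : Type*} [MeasurableSpace β] [Nonempty β]
    {f : Sample G → β} (hf : Measurable fun ω : {ω : Sample G // Good ω} => f ω.1) :
    AEMeasurable f (sampleLaw G) := by
  classical
  obtain ⟨c⟩ := ‹Nonempty β›
  refine ⟨fun ω => if Good ω then f ω else c, ?_, ?_⟩
  · refine measurable_of_restrict_of_restrict_compl measurableSet_good ?_ ?_
    · have : ({ω : Sample G | Good ω}).domRestrict (fun ω => if Good ω then f ω else c) =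
          fun ω => f ω.1 := funext fun ω => if_pos ω.2
      rw [this]
      exact hf
    · have : ({ω : Sample G | Good ω}ᶜ).domRestrict (fun ω => if Good ω then f ω else c) =
          fun _ => c := funext fun ω => if_neg ω.2
      rw [this]
      exact measurable_const
  · filter_upwards [ae_good] with ω hω
    rw [if_pos hω]

end Schedule

/-! ### Stationarity, coalescence and the finite-volume laws. -/

section FiniteVolume

variable {V : Type*} {G : SimpleGraph V}

/-! ### Stationarity of the finite-volume measures -/

lemma weight_nonneg (K : Finset V) (b : BC) (θ : Param) (ξ : Config G) :
    0 ≤ weight G K b θ ξ := by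
  refine mul_nonneg (pow_nonneg (zero_le_one.trans θ.one_le_q) _)
    (Finset.prod_nonneg fun e _ => ?_)
  split_ifs
  · exact θ.p_nonneg
  · exact sub_nonneg.2 θ.p_le_one

lemma partitionFunction_pos (K : Finset V) (b : BC) (θ : Param) :
    0 < partitionFunction G K b θ := by
  classical
  have hq : ∀ n : ℕ, 0 < θ.q ^ n := fun n => pow_pos (zero_lt_one.trans_le θ.one_le_q) n
  refine Finset.sum_pos' (fun ξ _ => weight_nonneg K b θ _) ?_
  rcases θ.p_nonneg.eq_or_lt with hp | hp
  · refine ⟨fun _ => false, Finset.mem_univ _, mul_pos (hq _) (Finset.prod_pos fun e he => ?_)⟩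
    rw [extend_apply_of_mem he, ← hp]
    simp
  · refine ⟨fun _ => true, Finset.mem_univ _, mul_pos (hq _) (Finset.prod_pos fun e he => ?_)⟩
    rw [extend_apply_of_mem he]
    simpa using hp

/-- The probability of the configuration `ξ` under the finite-volume measure. -/
def prob (G : SimpleGraph V) (K : Finset V) (b : BC) (θ : Param) (ξ : Config G) : ENNReal :=
  ENNReal.ofReal (weight G K b θ ξ / partitionFunction G K b θ)

open Classical in
lemma sum_prob (K : Finset V) (b : BC) (θ : Param) :
    ∑ ξ : edgesIn G K → Bool, prob G K b θ (extend G K b ξ) = 1 := by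
  unfold prob
  rw [← ENNReal.ofReal_sum_of_nonneg
    fun ξ _ => div_nonneg (weight_nonneg K b θ _) (partitionFunction_pos K b θ).le,
    ← Finset.sum_div]
  change ENNReal.ofReal (partitionFunction G K b θ / partitionFunction G K b θ) = 1
  rw [div_self (partitionFunction_pos K b θ).ne', ENNReal.ofReal_one]

open Classical in
lemma finiteRC_apply (K : Finset V) (b : BC) (θ : Param) {A : Set (Config G)}
    (hA : MeasurableSet A) :
    finiteRC G K b θ A = ∑ ξ : edgesIn G K → Bool,
      prob G K b θ (extend G K b ξ) * A.indicator 1 (extend G K b ξ) := by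
  simp only [finiteRC, Measure.coe_finsetSum, Finset.sum_apply, Measure.smul_apply, smul_eq_mul,
    Measure.dirac_apply' _ hA, prob]

lemma openProb_nonneg (K : Finset V) (b : BC) (θ : Param) (ξ : Config G) (e : G.edgeSet) :
    0 ≤ openProb G K b θ ξ e :=
  θ.low_nonneg.trans (low_le_openProb K b θ ξ e)

lemma openProb_le_one (K : Finset V) (b : BC) (θ : Param) (ξ : Config G) (e : G.edgeSet) :
    openProb G K b θ ξ e ≤ 1 :=
  (openProb_le_p K b θ ξ e).trans θ.p_le_one

open Classical in
/-- The expectation of `F` after the heat-bath update of `e`. -/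
def heatBathMean (G : SimpleGraph V) (K : Finset V) (b : BC) (θ : Param) (e : G.edgeSet)
    (F : Config G → ENNReal) (ξ : Config G) : ENNReal :=
  ENNReal.ofReal (openProb G K b θ ξ e) * F (Function.update ξ e true) +
    ENNReal.ofReal (1 - openProb G K b θ ξ e) * F (Function.update ξ e false)

open Classical in
-- By detailed balance, `openProb` is the conditional probability of `e` being open: redistributing
-- the mass of the pair gives back each weight.
lemma prob_update (K : Finset V) (b : BC) (θ : Param) (ξ : Config G) {e : G.edgeSet}
    (he : e ∈ edgesIn G K) :
    (prob G K b θ (Function.update ξ e true) + prob G K b θ (Function.update ξ e false)) *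
        ENNReal.ofReal (openProb G K b θ ξ e) = prob G K b θ (Function.update ξ e true) ∧
    (prob G K b θ (Function.update ξ e true) + prob G K b θ (Function.update ξ e false)) *
        ENNReal.ofReal (1 - openProb G K b θ ξ e) = prob G K b θ (Function.update ξ e false) := by
  have hZ := partitionFunction_pos (G := G) K b θ
  have h0 : ∀ ζ, 0 ≤ weight G K b θ ζ / partitionFunction G K b θ := fun ζ =>
    div_nonneg (weight_nonneg K b θ ζ) hZ.le
  have hw := weight_update b θ ξ he
  unfold prob
  rw [← ENNReal.ofReal_add (h0 _) (h0 _), ← ENNReal.ofReal_mul (add_nonneg (h0 _) (h0 _)),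
    ← ENNReal.ofReal_mul (add_nonneg (h0 _) (h0 _)), ← add_div]
  constructor
  · congr 1
    rw [div_mul_eq_mul_div]
    congr 1
    linear_combination -hw
  · congr 1
    rw [div_mul_eq_mul_div]
    congr 1
    linear_combination hw

open Classical in
lemma update_extend (K : Finset V) (b : BC) (ξ : edgesIn G K → Bool) {e : G.edgeSet}
    (he : e ∈ edgesIn G K) (v : Bool) :
    Function.update (extend G K b ξ) e v = extend G K b (Function.update ξ ⟨e, he⟩ v) := by
  funext f
  by_cases hf : f = e
  · subst hf
    rw [Function.update_self, extend_apply_of_mem he, Function.update_self]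
  · rw [Function.update_of_ne hf]
    by_cases hf' : f ∈ edgesIn G K
    · rw [extend_apply_of_mem hf', extend_apply_of_mem hf', Function.update_of_ne]
      simpa using hf
    · rw [extend_apply_of_notMem hf', extend_apply_of_notMem hf']

open Classical in
/-- The finite-volume measure is invariant under the heat-bath update of an edge. -/
lemma sum_prob_heatBathMean (K : Finset V) (b : BC) (θ : Param) {e : G.edgeSet}
    (he : e ∈ edgesIn G K) (F : Config G → ENNReal) :
    ∑ ξ : edgesIn G K → Bool,
        prob G K b θ (extend G K b ξ) * heatBathMean G K b θ e F (extend G K b ξ) =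
      ∑ ξ : edgesIn G K → Bool, prob G K b θ (extend G K b ξ) * F (extend G K b ξ) := by
  -- Configurations are paired by toggling `e`; summing twice avoids choosing a representative of
  -- each pair.
  let flip : (edgesIn G K → Bool) → edgesIn G K → Bool := fun ξ =>
    Function.update ξ ⟨e, he⟩ (!ξ ⟨e, he⟩)
  have hflip : Function.Involutive flip := by
    intro ξ
    simp [flip]
  have hsum : ∀ g : (edgesIn G K → Bool) → ENNReal,
      2 * ∑ ξ, g ξ = ∑ ξ, (g ξ + g (flip ξ)) := by
    intro g
    rw [Finset.sum_add_distrib, two_mul]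
    congr 1
    exact (Equiv.sum_comp hflip.toPerm g).symm
  refine (ENNReal.mul_right_inj two_ne_zero ENNReal.ofNat_ne_top).1 ?_
  rw [hsum, hsum]
  refine Finset.sum_congr rfl fun ξ _ => ?_
  set ζ := extend G K b ξ
  have hpair : ∀ g : Config G → ENNReal, g ζ + g (extend G K b (flip ξ)) =
      g (Function.update ζ e true) + g (Function.update ζ e false) := by
    intro g
    have h1 : extend G K b (flip ξ) = Function.update ζ e (!ζ e) := by
      rw [update_extend K b ξ he, show ζ e = ξ ⟨e, he⟩ from extend_apply_of_mem he]
    have h2 : ζ = Function.update ζ e (ζ e) := (Function.update_eq_self _ _).symm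
    rw [h1]
    cases hv : ζ e
    · rw [hv] at h2
      rw [Bool.not_false, add_comm, ← h2]
    · rw [hv] at h2
      rw [Bool.not_true, ← h2]
  rw [hpair fun ζ => prob G K b θ ζ * heatBathMean G K b θ e F ζ,
    hpair fun ζ => prob G K b θ ζ * F ζ]
  have hmean : ∀ v, heatBathMean G K b θ e F (Function.update ζ e v) =
      heatBathMean G K b θ e F ζ := by
    intro v
    simp only [heatBathMean, openProb_update, Function.update_idem]
  rw [hmean, hmean, ← add_mul]
  obtain ⟨h1, h2⟩ := prob_update K b θ ζ he
  unfold heatBathMean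
  rw [mul_add, ← mul_assoc, ← mul_assoc, h1, h2]

lemma unifLaw_Iio {a : ℝ} (h1 : a ≤ 1) : unifLaw (Iio a) = ENNReal.ofReal a := by
  rw [unifLaw, Measure.restrict_apply measurableSet_Iio]
  have : Iio a ∩ Icc 0 1 = Ico 0 a := by
    ext x
    simp only [mem_inter_iff, mem_Iio, mem_Icc, mem_Ico]
    constructor
    · rintro ⟨h, h', -⟩
      exact ⟨h', h⟩
    · rintro ⟨h, h'⟩
      exact ⟨h', h, h'.le.trans h1⟩
  rw [this, Real.volume_Ico, sub_zero]

lemma unifLaw_Ici {a : ℝ} (h0 : 0 ≤ a) (h1 : a ≤ 1) :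
    unifLaw (Ici a) = ENNReal.ofReal (1 - a) := by
  rw [← compl_Iio, prob_compl_eq_one_sub measurableSet_Iio, unifLaw_Iio h1,
    ENNReal.ofReal_sub _ h0, ENNReal.ofReal_one]

lemma lintegral_unifLaw_decide {a : ℝ} (h0 : 0 ≤ a) (h1 : a ≤ 1) (H : Bool → ENNReal) :
    ∫⁻ u, H (decide (u < a)) ∂unifLaw =
      ENNReal.ofReal a * H true + ENNReal.ofReal (1 - a) * H false := by
  classical
  have : ∀ u, H (decide (u < a)) =
      (Iio a).piecewise (fun _ => H true) (fun _ => H false) u := by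
    intro u
    by_cases hu : u < a <;> simp [Set.piecewise, hu]
  simp only [this]
  rw [lintegral_piecewise measurableSet_Iio, setLIntegral_const, setLIntegral_const, compl_Iio,
    unifLaw_Iio h1, unifLaw_Ici h0 h1, mul_comm, mul_comm (H false)]

lemma foldl_heatBath_congr (K : Finset V) (b : BC) (θ : Param) {L : List (G.edgeSet × ℕ)}
    {U U' : G.edgeSet × ℕ → ℝ} (h : ∀ i ∈ L, U i = U' i) (ξ : Config G) :
    L.foldl (heatBath G K b θ U) ξ = L.foldl (heatBath G K b θ U') ξ := by
  refine List.foldl_ext _ _ _ fun ζ i hi => ?_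
  simp only [heatBath, h i hi]

open Classical in
-- The mark of the first event occurs nowhere else in the duplicate-free list, so integrating it out
-- first gives one heat-bath step, which preserves the weights.
lemma sum_prob_lintegral_foldl (K : Finset V) (b : BC) (θ : Param) {F : Config G → ENNReal}
    (hF : Measurable F) {L : List (G.edgeSet × ℕ)} (hL : L.Nodup)
    (hLK : ∀ i ∈ L, i.1 ∈ edgesIn G K) :
    ∑ ξ : edgesIn G K → Bool, prob G K b θ (extend G K b ξ) *
        ∫⁻ U, F (L.foldl (heatBath G K b θ U) (extend G K b ξ)) ∂markFieldLaw G =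
      ∑ ξ : edgesIn G K → Bool, prob G K b θ (extend G K b ξ) * F (extend G K b ξ) := by
  induction L with
  | nil => simp
  | cons i L ih =>
    rw [List.nodup_cons] at hL
    have hmeas : ∀ (L : List (G.edgeSet × ℕ)) ζ, Measurable fun U : G.edgeSet × ℕ → ℝ =>
        F (L.foldl (heatBath G K b θ U) ζ) := fun L ζ =>
      hF.comp (measurable_foldl_heatBath K b θ L measurable_id measurable_const)
    have key : ∀ ζ, ∫⁻ U, F ((i :: L).foldl (heatBath G K b θ U) ζ) ∂markFieldLaw G =
        heatBathMean G K b θ i.1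
          (fun ζ => ∫⁻ U, F (L.foldl (heatBath G K b θ U) ζ) ∂markFieldLaw G) ζ := by
      intro ζ
      rw [markFieldLaw, lintegral_infinitePi_update unifLaw i (hmeas _ ζ)]
      have hinner : ∀ U : G.edgeSet × ℕ → ℝ,
          ∫⁻ u, F ((i :: L).foldl (heatBath G K b θ (Function.update U i u)) ζ) ∂unifLaw =
          ENNReal.ofReal (openProb G K b θ ζ i.1) *
            F (L.foldl (heatBath G K b θ U) (Function.update ζ i.1 true)) +
          ENNReal.ofReal (1 - openProb G K b θ ζ i.1) *
            F (L.foldl (heatBath G K b θ U) (Function.update ζ i.1 false)) := by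
        intro U
        rw [← lintegral_unifLaw_decide (openProb_nonneg K b θ ζ i.1) (openProb_le_one K b θ ζ i.1)
          fun v => F (L.foldl (heatBath G K b θ U) (Function.update ζ i.1 v))]
        refine lintegral_congr fun u => ?_
        rw [List.foldl_cons, foldl_heatBath_congr (U' := U)]
        · simp only [heatBath, Function.update_self]
        · intro j hj
          exact Function.update_of_ne (by rintro rfl; exact hL.1 hj) _ _
      rw [lintegral_congr hinner, lintegral_add_left ((hmeas L _).const_mul _),
        lintegral_const_mul _ (hmeas L _), lintegral_const_mul _ (hmeas L _)]
      rfl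
    simp only [key]
    rw [sum_prob_heatBathMean K b θ (hLK i List.mem_cons_self)]
    exact ih hL.2 fun j hj => hLK j (List.mem_cons_of_mem _ hj)

/-! ### Coalescence -/

lemma eq_filter_append_filter {α : Type*} {f : α → ℝ} (t : ℝ) {L : List α}
    (h : L.Pairwise fun i j => f i > f j) :
    L = L.filter (fun i => t ≤ f i) ++ L.filter (fun i => f i < t) := by
  induction L with
  | nil => rfl
  | cons i L ih =>
    rw [List.pairwise_cons] at h
    by_cases hi : t ≤ f i
    · rw [List.filter_cons_of_pos (by simpa using hi),
        List.filter_cons_of_neg (by simpa using hi), List.cons_append, ← ih h.2]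
    · have hL : ∀ j ∈ L, f j < t := fun j hj => (h.1 j hj).trans (not_le.1 hi)
      have h1 : L.filter (fun i => t ≤ f i) = [] := by
        rw [List.filter_eq_nil_iff]
        intro j hj
        simpa using hL j hj
      have h2 : L.filter (fun i => f i < t) = L := by
        rw [List.filter_eq_self]
        intro j hj
        simpa using hL j hj
      rw [List.filter_cons_of_neg (by simpa using hi),
        List.filter_cons_of_pos (by simpa using hi), h1, h2, List.nil_append]

lemma foldl_heatBath_apply_of_forall_ne (K : Finset V) (b : BC) (θ : Param)
    {L : List (G.edgeSet × ℕ)} (U : G.edgeSet × ℕ → ℝ) {e : G.edgeSet} (h : ∀ i ∈ L, i.1 ≠ e)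
    (ξ : Config G) : L.foldl (heatBath G K b θ U) ξ e = ξ e := by
  classical
  induction L generalizing ξ with
  | nil => rfl
  | cons i L ih =>
    rw [List.foldl_cons, ih fun j hj => h j (List.mem_cons_of_mem _ hj), heatBath,
      Function.update_of_ne (h i List.mem_cons_self).symm]

/-- If the last update of every edge before time `-t` has a mark in a set `B` on which the update
does not depend on the configuration, then the state at time `0` does not depend on the start. -/
lemma Good.run_eq_run {ω : Sample G} (hω : Good ω) {K : Finset V} {b : BC} {θ : Param}
    {B : Set ℝ} {v : Bool} (hB : ∀ u ∈ B, ∀ (ξ : Config G) (e : G.edgeSet),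
      decide (u < openProb G K b θ ξ e) = v) {t T : ℝ}
    (ht : ∀ e ∈ edgesIn G K, ∃ k, t ≤ clockTime ω e k ∧ clockTime ω e k < T ∧
      (∀ l < k, clockTime ω e l < t) ∧ (ω (e, k)).2 ∈ B)
    {ξ ξ' : Config G} (hξ : ∀ e ∉ edgesIn G K, ξ e = ξ' e) :
    run G K b θ ω T ξ = run G K b θ ω T ξ' := by
  classical
  obtain ⟨L, hL⟩ := hω.exists_isSchedule K T
  rw [hL.run_eq hω, hL.run_eq hω,
    eq_filter_append_filter (f := fun i : G.edgeSet × ℕ => clockTime ω i.1 i.2) t hL.pairwise,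
    List.foldl_append, List.foldl_append]
  set L₁ := L.filter fun i => t ≤ clockTime ω i.1 i.2 with hL₁
  have hmem : ∀ i, i ∈ L₁ ↔ (i.1 ∈ edgesIn G K ∧ clockTime ω i.1 i.2 < T) ∧
      t ≤ clockTime ω i.1 i.2 := by
    intro i
    rw [hL₁, List.mem_filter, hL.mem_iff]
    simp
  -- The events after `L₁` are common to both runs, so it suffices that the states at the splitting
  -- time agree.
  congr 1
  funext e
  by_cases he : e ∈ edgesIn G K
  · obtain ⟨k, h1, h2, h3, h4⟩ := ht e he
    obtain ⟨L₂, L₃, hsplit⟩ := List.append_of_mem ((hmem (e, k)).2 ⟨⟨he, h2⟩, h1⟩)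
    have hpair : L₁.Pairwise fun i j => clockTime ω i.1 i.2 > clockTime ω j.1 j.2 :=
      hL.pairwise.filter _
    -- A later event of `e` would have a smaller index, hence ring time below `t`, outside `L₁`.
    have hne : ∀ i ∈ L₃, i.1 ≠ e := by
      rintro ⟨f, l⟩ hi rfl
      rw [hsplit, List.pairwise_append, List.pairwise_cons] at hpair
      have hlt := hpair.2.1.1 _ hi
      have hlk : l < k := (clockTime_strictMono hω.pos _).lt_iff_lt.1 hlt
      have hm : ((f, l) : G.edgeSet × ℕ) ∈ L₁ := by
        rw [hsplit]
        exact List.mem_append_right _ (List.mem_cons_of_mem _ hi)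
      exact absurd ((hmem _).1 hm).2 (not_le.2 (h3 l hlk))
    have hval : ∀ ζ : Config G, L₁.foldl (heatBath G K b θ fun j => (ω j).2) ζ e = v := by
      intro ζ
      rw [hsplit, List.foldl_append, List.foldl_cons,
        foldl_heatBath_apply_of_forall_ne K b θ _ hne, heatBath, Function.update_self]
      exact hB _ h4 _ _
    rw [hval, hval]
  · have hne : ∀ i ∈ L₁, i.1 ≠ e := by
      rintro i hi rfl
      exact he ((hmem i).1 hi).1.1
    rw [foldl_heatBath_apply_of_forall_ne K b θ _ hne,
      foldl_heatBath_apply_of_forall_ne K b θ _ hne, hξ e he]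

/-- Marks in a suitable set of positive probability determine the updated state. -/
lemma exists_forcing_set (K : Finset V) (b : BC) (θ : Param) :
    ∃ (B : Set ℝ) (v : Bool), MeasurableSet B ∧ unifLaw B ≠ 0 ∧
      ∀ u ∈ B, ∀ (ξ : Config G) (e : G.edgeSet), decide (u < openProb G K b θ ξ e) = v := by
  rcases θ.p_nonneg.eq_or_lt with hp | hp
  -- At `p = 0` the set `Iio θ.low` is null; instead every nonnegative mark closes the edge.
  · refine ⟨Ici 0, false, measurableSet_Ici, ?_, fun u hu ξ e => ?_⟩
    · rw [unifLaw_Ici le_rfl zero_le_one]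
      simp
    · rw [decide_eq_false_iff_not, not_lt]
      exact (openProb_le_p K b θ ξ e).trans (hp.symm.le.trans hu)
  · refine ⟨Iio θ.low, true, measurableSet_Iio, ?_, fun u hu ξ e => ?_⟩
    · rw [unifLaw_Iio (θ.low_le_p.trans θ.p_le_one)]
      have : 0 < θ.low := div_pos hp θ.denom_pos
      simpa using this
    · rw [decide_eq_true_eq]
      exact lt_of_lt_of_le hu (low_le_openProb K b θ ξ e)

/-- With the clocks fixed, choose deterministic windows in each of which every edge of `E(K)` rings.
A window succeeds if the mark at the smallest ring time of each edge in it lies in the forcing set.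
Different windows use disjoint marks, so almost surely one succeeds. -/
lemma ae_exists_coalescence {φ : G.edgeSet × ℕ → ℝ} (hφ : ∀ U, Good (zip (φ, U) : Sample G))
    (K : Finset V) (b : BC) (θ : Param) :
    ∀ᵐ U ∂markFieldLaw G, ∃ T₀ : ℝ, ∀ T ≥ T₀, ∀ ξ ξ' : Config G,
      (∀ e ∉ edgesIn G K, ξ e = ξ' e) →
      run G K b θ (zip (φ, U)) T ξ = run G K b θ (zip (φ, U)) T ξ' := by
  classical
  obtain ⟨B, v, hBm, hB0, hB⟩ := exists_forcing_set (G := G) K b θ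
  let c : G.edgeSet → ℕ → ℝ := clockTime (zip (φ, fun _ => 0) : Sample G)
  have hgood := hφ fun _ => 0
  have hc : ∀ e, StrictMono (c e) := clockTime_strictMono hgood.pos
  have hc0 : ∀ e k, 0 < c e k := clockTime_pos hgood.pos
  have hex : ∀ (t : ℝ) e, ∃ k, t ≤ c e k := fun t e =>
    ((hgood.nonexplosive e).eventually_ge_atTop t).exists
  let idx : ℝ → G.edgeSet → ℕ := fun t e => Nat.find (hex t e)
  have hidx : ∀ t e, t ≤ c e (idx t e) := fun t e => Nat.find_spec (hex t e)
  have hidx' : ∀ t e, ∀ l < idx t e, c e l < t := fun t e l hl =>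
    not_le.1 (Nat.find_min (hex t e) hl)
  -- A sum of positive ring times dominates each of them; the `1` makes the bound strict.
  let next : ℝ → ℝ := fun t => 1 + ∑ e ∈ edgesIn G K, c e (idx t e)
  have hnext : ∀ t, ∀ e ∈ edgesIn G K, c e (idx t e) < next t := by
    intro t e he
    have := Finset.single_le_sum (f := fun e => c e (idx t e)) (fun e _ => (hc0 e _).le) he
    simp only [next]
    linarith
  let t : ℕ → ℝ := fun m => next^[m] 0
  have ht : ∀ m, t (m + 1) = next (t m) := fun m => Function.iterate_succ_apply' next m 0
  have hmono : ∀ e ∈ edgesIn G K, StrictMono fun m => idx (t m) e := by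
    intro e he
    refine strictMono_nat_of_lt_succ fun m => (hc e).lt_iff_lt.1 ?_
    refine lt_of_lt_of_le (hnext (t m) e he) ?_
    rw [← ht]
    exact hidx _ e
  let S : ℕ → Finset (G.edgeSet × ℕ) := fun m => (edgesIn G K).image fun e => (e, idx (t m) e)
  have hS : Pairwise fun m n => Disjoint (S m) (S n) := by
    intro m n hmn
    rw [Finset.disjoint_left]
    intro i hi hi'
    obtain ⟨e, he, rfl⟩ := Finset.mem_image.1 hi
    obtain ⟨f, hf, hfe⟩ := Finset.mem_image.1 hi'
    obtain ⟨rfl, h⟩ := Prod.mk.inj hfe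
    exact hmn ((hmono _ he).injective h.symm)
  filter_upwards [ae_frequently_forall_mem unifLaw hS hBm hB0
    (N := (edgesIn G K).card) fun m => Finset.card_image_le] with U hU
  obtain ⟨m, hm⟩ := hU.exists
  refine ⟨next (t m), fun T hT ξ ξ' hξ => (hφ U).run_eq_run hB (t := t m) (fun e he => ?_) hξ⟩
  exact ⟨idx (t m) e, hidx _ e, (hnext _ e he).trans_le hT, hidx' _ e,
    hm _ (Finset.mem_image_of_mem _ he)⟩

/-! ### The law of the finite-volume configurations -/

lemma eventually_run_eq_finiteX {ω : Sample G} (hω : Nonexplosive ω) (K : Finset V) (b : BC)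
    (θ : Param) :
    ∀ᶠ T : ℝ in atTop, run G K b θ ω T (fun _ => b.state) = finiteX G K b θ ω := by
  have hout : ∀ e ∉ edgesIn G K, finiteX G K b θ ω e = b.state := by
    intro e he
    obtain ⟨T, hT⟩ := (eventually_chain_eq_finiteX hω K b θ e).exists
    rw [← hT, chain_eq_run, run_apply_of_notMem he]
  have hin : ∀ᶠ T : ℝ in atTop, ∀ e ∈ edgesIn G K,
      chain G K b θ ω T 0 e = finiteX G K b θ ω e := by
    rw [Filter.eventually_all_finset]
    exact fun e _ => eventually_chain_eq_finiteX hω K b θ e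
  filter_upwards [hin] with T hT
  funext e
  by_cases he : e ∈ edgesIn G K
  · rw [← hT e he, chain_eq_run]
  · rw [run_apply_of_notMem he, hout e he]

lemma measurable_comp_zip {β : Type*} [MeasurableSpace β] {φ : G.edgeSet × ℕ → ℝ}
    (hφ : ∀ U, Good (zip (φ, U) : Sample G)) {f : Sample G → β}
    (hf : Measurable fun ω : {ω : Sample G // Good ω} => f ω.1) :
    Measurable fun U => f (zip (φ, U)) := by
  have : Measurable fun U => (⟨zip (φ, U), hφ U⟩ : {ω : Sample G // Good ω}) :=
    (measurable_zip.comp (measurable_const.prodMk measurable_id)).subtype_mk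
  exact hf.comp this

variable [Countable V]

/-- Given the clocks, the marks make the finite-volume configuration random-cluster
distributed. -/
lemma markFieldLaw_finiteX {φ : G.edgeSet × ℕ → ℝ} (hφ : ∀ U, Good (zip (φ, U) : Sample G))
    (K : Finset V) (b : BC) (θ : Param) {A : Set (Config G)} (hA : MeasurableSet A) :
    markFieldLaw G {U | finiteX G K b θ (zip (φ, U)) ∈ A} = finiteRC G K b θ A := by
  classical
  -- By coalescence every start leads to the same limit.
  have hlim : ∀ ξ : edgesIn G K → Bool, Tendsto (fun n : ℕ =>
      markFieldLaw G {U | run G K b θ (zip (φ, U)) n (extend G K b ξ) ∈ A}) atTop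
      (𝓝 (markFieldLaw G {U | finiteX G K b θ (zip (φ, U)) ∈ A})) := by
    intro ξ
    refine tendsto_measure_of_ae_tendsto_indicator_of_isFiniteMeasure _
      (measurable_comp_zip hφ (measurable_finiteX_good K b θ) hA)
      (fun n => measurable_comp_zip hφ (f := fun ω => run G K b θ ω n (extend G K b ξ))
        (measurable_run_good K b θ n _) hA) ?_
    filter_upwards [ae_exists_coalescence hφ K b θ] with U hU
    obtain ⟨T₀, hT₀⟩ := hU
    have h1 := tendsto_natCast_atTop_atTop.eventually
      ((eventually_run_eq_finiteX (hφ U).nonexplosive K b θ).and (eventually_ge_atTop T₀))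
    filter_upwards [h1] with n hn
    rw [← hn.1, hT₀ n hn.2 (extend G K b ξ) fun _ => b.state]
    exact fun e he => extend_apply_of_notMem he
  -- Started from the random-cluster weights, the law is exact for every run length.
  have hsum : ∀ n : ℕ, ∑ ξ : edgesIn G K → Bool, prob G K b θ (extend G K b ξ) *
      markFieldLaw G {U | run G K b θ (zip (φ, U)) n (extend G K b ξ) ∈ A} =
      finiteRC G K b θ A := by
    intro n
    obtain ⟨L, hL⟩ := (hφ fun _ => 0).exists_isSchedule K n
    rw [finiteRC_apply K b θ hA,
      ← sum_prob_lintegral_foldl K b θ (measurable_one.indicator hA) hL.nodup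
        fun i hi => ((hL.mem_iff i).1 hi).1]
    refine Finset.sum_congr rfl fun ξ _ => ?_
    congr 1
    have hm : MeasurableSet {U | run G K b θ (zip (φ, U)) n (extend G K b ξ) ∈ A} :=
      measurable_comp_zip hφ (f := fun ω => run G K b θ ω n (extend G K b ξ))
        (measurable_run_good K b θ n _) hA
    rw [← lintegral_indicator_one hm]
    refine lintegral_congr fun U => ?_
    -- The schedule depends on `φ` only, so the one found for zero marks works for every `U`.
    have hLU : IsSchedule K (zip (φ, U) : Sample G) n L := ⟨hL.mem_iff, hL.pairwise⟩
    have hrun := hLU.run_eq (hφ U) b θ (extend G K b ξ)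
    simp only [Set.indicator, mem_ofPred_eq, hrun]
    rfl
  have h1 : Tendsto (fun n : ℕ => ∑ ξ : edgesIn G K → Bool, prob G K b θ (extend G K b ξ) *
      markFieldLaw G {U | run G K b θ (zip (φ, U)) n (extend G K b ξ) ∈ A}) atTop
      (𝓝 (∑ ξ : edgesIn G K → Bool, prob G K b θ (extend G K b ξ) *
        markFieldLaw G {U | finiteX G K b θ (zip (φ, U)) ∈ A})) :=
    tendsto_finsetSum _ fun ξ _ =>
      ENNReal.Tendsto.const_mul (hlim ξ) (.inr ENNReal.ofReal_ne_top)
  simp only [hsum] at h1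
  rw [← Finset.sum_mul, sum_prob, one_mul] at h1
  exact tendsto_nhds_unique h1 tendsto_const_nhds |>.symm ▸ rfl

lemma aemeasurable_finiteX (K : Finset V) (b : BC) (θ : Param) :
    AEMeasurable (finiteX G K b θ) (sampleLaw G) :=
  aemeasurable_of_measurable_good (measurable_finiteX_good K b θ)

lemma measurableSet_good_inter {β : Type*} [MeasurableSpace β] {f : Sample G → β}
    (hf : Measurable fun ω : {ω : Sample G // Good ω} => f ω.1) {A : Set β}
    (hA : MeasurableSet A) : MeasurableSet {ω : Sample G | Good ω ∧ f ω ∈ A} := by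
  convert measurableSet_good.subtype_image (hf hA) using 1
  ext ω
  simp [and_comm]

lemma map_apply_of_measurable_good {β : Type*} [MeasurableSpace β] [Nonempty β]
    {f : Sample G → β} (hf : Measurable fun ω : {ω : Sample G // Good ω} => f ω.1) {A : Set β}
    (hA : MeasurableSet A) :
    (sampleLaw G).map f A = sampleLaw G {ω : Sample G | Good ω ∧ f ω ∈ A} := by
  rw [Measure.map_apply_of_aemeasurable (aemeasurable_of_measurable_good hf) hA]
  refine measure_congr ?_
  filter_upwards [ae_good (G := G)] with ω hω
  exact propext ⟨fun h => ⟨hω, h⟩, fun h => h.2⟩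

/-- The conditional law given the clocks is the same for almost every `φ`; integrate it out. -/
lemma map_finiteX (K : Finset V) (b : BC) (θ : Param) :
    (sampleLaw G).map (finiteX G K b θ) = finiteRC G K b θ := by
  ext A hA
  have hM := measurableSet_good_inter (measurable_finiteX_good (G := G) K b θ) hA
  rw [map_apply_of_measurable_good (measurable_finiteX_good K b θ) hA, sampleLaw_eq_map_zip,
    Measure.map_apply measurable_zip hM, Measure.prod_apply (measurable_zip hM)]
  have h2 : ∀ᵐ φ ∂clockLaw G, markFieldLaw G (Prod.mk φ ⁻¹'
      (zip ⁻¹' {ω : Sample G | Good ω ∧ finiteX G K b θ ω ∈ A})) = finiteRC G K b θ A := by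
    filter_upwards [ae_clockLaw_good] with φ hφ
    rw [← markFieldLaw_finiteX hφ K b θ hA]
    congr 1
    ext U
    exact ⟨fun h => h.2, fun h => ⟨hφ U, h⟩⟩
  rw [lintegral_congr_ae h2, lintegral_const, measure_univ, mul_one]

end FiniteVolume

/-! ### Automorphism invariance and the infinite-volume laws. -/

section InfiniteVolume

variable {V : Type*} {G : SimpleGraph V}

/-! ### Automorphisms -/

/-- The sample seen through an automorphism. -/
def pullSample (γ : G ≃g G) (ω : Sample G) : Sample G := fun i => ω (γ.mapEdgeSet i.1, i.2)

/-- The configuration seen through an automorphism. -/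
def pullConfig (γ : G ≃g G) (ξ : Config G) : Config G := fun e => ξ (γ.mapEdgeSet e)

/-- Here and below, `hK` expresses `K' = γ⁻¹(K)`. -/
lemma mem_edgesIn_mapEdgeSet (γ : G ≃g G) {K K' : Finset V} (hK : ∀ x, x ∈ K' ↔ γ x ∈ K)
    (e : G.edgeSet) : γ.mapEdgeSet e ∈ edgesIn G K ↔ e ∈ edgesIn G K' := by
  obtain ⟨e, he⟩ := e
  induction e using Sym2.ind with
  | _ x y =>
    rw [mk_mem_edgesIn, hK, hK]
    exact mk_mem_edgesIn _

lemma mem_innerBoundary_map (γ : G ≃g G) {K K' : Finset V} (hK : ∀ x, x ∈ K' ↔ γ x ∈ K) {x : V}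
    (hx : x ∈ innerBoundary G K') : γ x ∈ innerBoundary G K := by
  obtain ⟨h1, y, hy, hadj⟩ := hx
  exact ⟨(hK x).1 h1, γ y, fun h => hy ((hK y).2 h), γ.map_rel_iff.2 hadj⟩

lemma openGraph_reachable_map (γ : G ≃g G) {K K' : Finset V} (hK : ∀ x, x ∈ K' ↔ γ x ∈ K)
    {ξ : Config G} {x y : K'} (h : (openGraph G K' (pullConfig γ ξ)).Reachable x y) :
    (openGraph G K ξ).Reachable ⟨γ x, (hK x).1 x.2⟩ ⟨γ y, (hK y).1 y.2⟩ := by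
  let f : openGraph G K' (pullConfig γ ξ) →g openGraph G K ξ :=
    { toFun := fun x => ⟨γ x, (hK x).1 x.2⟩
      map_rel' := by
        rintro a b ⟨hab, hξ⟩
        exact ⟨γ.map_rel_iff.2 hab, hξ⟩ }
  exact h.map f

open Classical in
lemma pullConfig_update (γ : G ≃g G) (ξ : Config G) (e : G.edgeSet) (v : Bool) :
    pullConfig γ (Function.update ξ (γ.mapEdgeSet e) v) =
      Function.update (pullConfig γ ξ) e v :=
  Function.update_comp_eq_of_injective ξ γ.mapEdgeSet.injective e v

lemma Joined.map (γ : G ≃g G) {K K' : Finset V} (hK : ∀ x, x ∈ K' ↔ γ x ∈ K) {b : BC}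
    {ξ : Config G} {e : G.edgeSet} (h : Joined G K' b (pullConfig γ ξ) e) :
    Joined G K b ξ (γ.mapEdgeSet e) := by
  classical
  obtain ⟨x, y, he, hJ⟩ := h
  simp only [← pullConfig_update] at hJ
  refine ⟨⟨γ x, (hK x).1 x.2⟩, ⟨γ y, (hK y).1 y.2⟩, ?_, ?_⟩
  · change Sym2.map γ (e : Sym2 V) = _
    rw [he, Sym2.map_mk]
  · rcases hJ with hJ | ⟨hb, ⟨u, hu, hxu⟩, v, hv, hyv⟩
    · exact .inl (openGraph_reachable_map γ hK hJ)
    · exact .inr ⟨hb, ⟨_, mem_innerBoundary_map γ hK hu, openGraph_reachable_map γ hK hxu⟩,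
        ⟨_, mem_innerBoundary_map γ hK hv, openGraph_reachable_map γ hK hyv⟩⟩

lemma mapEdgeSet_symm_apply (γ : G ≃g G) (e : G.edgeSet) :
    γ.symm.mapEdgeSet (γ.mapEdgeSet e) = e :=
  γ.mapEdgeSet.symm_apply_apply e

lemma joined_pullConfig_iff (γ : G ≃g G) {K K' : Finset V} (hK : ∀ x, x ∈ K' ↔ γ x ∈ K) {b : BC}
    {ξ : Config G} {e : G.edgeSet} :
    Joined G K' b (pullConfig γ ξ) e ↔ Joined G K b ξ (γ.mapEdgeSet e) := by
  refine ⟨Joined.map γ hK, fun h => ?_⟩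
  -- The converse is the forward direction for `γ⁻¹`.
  have hK' : ∀ x, x ∈ K ↔ γ.symm x ∈ K' := fun x => by rw [hK, γ.apply_symm_apply]
  have hξ : pullConfig γ.symm (pullConfig γ ξ) = ξ := by
    funext f
    exact congrArg ξ (γ.mapEdgeSet.apply_symm_apply f)
  rw [← hξ] at h
  have := Joined.map γ.symm hK' h
  rwa [mapEdgeSet_symm_apply] at this

lemma pullConfig_step (γ : G ≃g G) {K K' : Finset V} (hK : ∀ x, x ∈ K' ↔ γ x ∈ K) (b : BC)
    (θ : Param) (ω : Sample G) (ξ : Config G) (s : ℝ) :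
    pullConfig γ (step G K b θ ω ξ s) =
      step G K' b θ (pullSample γ ω) (pullConfig γ ξ) s := by
  funext e
  have hprob : openProb G K b θ ξ (γ.mapEdgeSet e) =
      openProb G K' b θ (pullConfig γ ξ) e := by
    unfold openProb
    congr 1
    exact propext (joined_pullConfig_iff γ hK).symm
  simp only [pullConfig, step]
  rw [hprob]
  congr 1
  exact propext (and_congr_left' (mem_edgesIn_mapEdgeSet γ hK e))

lemma updateTimes_pullSample (γ : G ≃g G) {K K' : Finset V} (hK : ∀ x, x ∈ K' ↔ γ x ∈ K)
    (ω : Sample G) (T t : ℝ) :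
    updateTimes G K' (pullSample γ ω) T t = updateTimes G K ω T t := by
  ext s
  refine and_congr_right fun _ => and_congr_right fun _ => ?_
  constructor
  · rintro ⟨e, he, hk⟩
    exact ⟨γ.mapEdgeSet e, (mem_edgesIn_mapEdgeSet γ hK e).2 he, hk⟩
  · rintro ⟨e, he, hk⟩
    obtain ⟨f, rfl⟩ := γ.mapEdgeSet.surjective e
    exact ⟨f, (mem_edgesIn_mapEdgeSet γ hK f).1 he, hk⟩

lemma updateFinset_pullSample (γ : G ≃g G) {K K' : Finset V} (hK : ∀ x, x ∈ K' ↔ γ x ∈ K)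
    (ω : Sample G) (T : ℝ) : updateFinset G K' (pullSample γ ω) T = updateFinset G K ω T := by
  classical
  have h : ∀ S S' : Set ℝ, S = S' → (if h : S.Finite then h.toFinset else ∅) =
      if h : S'.Finite then h.toFinset else ∅ := by
    rintro S _ rfl
    rfl
  unfold updateFinset
  convert h _ _ (updateTimes_pullSample γ hK ω T 0)

lemma pullConfig_chain (γ : G ≃g G) {K K' : Finset V} (hK : ∀ x, x ∈ K' ↔ γ x ∈ K) (b : BC)
    (θ : Param) (ω : Sample G) (T : ℝ) :
    pullConfig γ (chain G K b θ ω T 0) = chain G K' b θ (pullSample γ ω) T 0 := by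
  rw [chain_eq_run, chain_eq_run]
  unfold run
  rw [updateFinset_pullSample γ hK]
  exact foldl_rel (R := fun ξ ζ => pullConfig γ ξ = ζ)
    (fun ξ ζ s h => by rw [pullConfig_step γ hK, h]) _ rfl

lemma pullConfig_finiteX (γ : G ≃g G) {K K' : Finset V} (hK : ∀ x, x ∈ K' ↔ γ x ∈ K) (b : BC)
    (θ : Param) (ω : Sample G) :
    pullConfig γ (finiteX G K b θ ω) = finiteX G K' b θ (pullSample γ ω) := by
  funext e
  simp only [finiteX, ← pullConfig_chain γ hK]
  rfl

/-- Both sides are `limUnder` of the same sequence, so convergence is not needed. -/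
lemma pullConfig_infiniteX (γ : G ≃g G) {W W' : ℕ → Finset V}
    (hW : ∀ i x, x ∈ W' i ↔ γ x ∈ W i) (b : BC) (θ : Param) (ω : Sample G) :
    pullConfig γ (infiniteX G W b θ ω) = infiniteX G W' b θ (pullSample γ ω) := by
  funext e
  simp only [infiniteX, ← pullConfig_finiteX γ (hW _)]
  rfl

lemma Good.pullSample {ω : Sample G} (hω : Good ω) (γ : G ≃g G) : Good (pullSample γ ω) := by
  refine ⟨fun i => hω.pos _, fun e => hω.nonexplosive (γ.mapEdgeSet e), ?_⟩
  rintro ⟨e, k⟩ ⟨f, l⟩ h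
  have := @hω.injective (γ.mapEdgeSet e, k) (γ.mapEdgeSet f, l) h
  obtain ⟨h1, h2⟩ := Prod.mk.inj this
  rw [γ.mapEdgeSet.injective h1, h2]

/-- Relabelling replaces the exhaustion by its preimage under `γ`; independence of the exhaustion
restores `W`. -/
lemma Good.relabel_jointX {ω : Sample G} (hω : Good ω) (γ : G ≃g G) {W : ℕ → Finset V}
    (hW : IsExhaustion W) :
    relabel γ (jointX G W ω) = jointX G W (RandomCluster.pullSample γ ω) := by
  let W' : ℕ → Finset V := fun i => (W i).map γ.symm.toEquiv.toEmbedding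
  have hmem : ∀ i x, x ∈ W' i ↔ γ x ∈ W i := by
    intro i x
    simp only [W', Finset.mem_map]
    constructor
    · rintro ⟨y, hy, rfl⟩
      have : γ (γ.symm y) = y := γ.apply_symm_apply y
      exact this.symm ▸ hy
    · intro h
      exact ⟨γ x, h, γ.symm_apply_apply x⟩
  have hW' : IsExhaustion W' := by
    refine ⟨fun i j hij x hx => ?_, fun x => ?_⟩
    · rw [hmem] at hx ⊢
      exact hW.mono hij hx
    · obtain ⟨i, hi⟩ := hW.cover (γ x)
      exact ⟨i, (hmem i x).2 hi⟩
  funext a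
  have h1 := pullConfig_infiniteX γ hmem a.1 a.2 ω
  rw [infiniteX_eq_of_exhaustions (hω.pullSample γ).nonexplosive hW' hW] at h1
  exact h1

lemma map_pullSample (γ : G ≃g G) : (sampleLaw G).map (pullSample γ) = sampleLaw G := by
  have hinj : Function.Injective fun i : G.edgeSet × ℕ => (γ.mapEdgeSet i.1, i.2) := by
    rintro ⟨e, k⟩ ⟨f, l⟩ h
    obtain ⟨h1, h2⟩ := Prod.mk.inj h
    exact Prod.ext (γ.mapEdgeSet.injective h1) h2
  exact Measure.map_infinitePi_infinitePi_of_inj (P := fun _ : G.edgeSet × ℕ => markLaw) hinj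

lemma measurable_pullSample (γ : G ≃g G) : Measurable (pullSample γ) :=
  measurable_pi_lambda _ fun _ => measurable_pi_apply _

variable [Countable V]

lemma aemeasurable_jointX {W : ℕ → Finset V} (hW : Monotone W) :
    AEMeasurable (jointX G W) (sampleLaw G) :=
  aemeasurable_of_measurable_good (measurable_jointX_good hW)

lemma map_relabel_jointX (γ : G ≃g G) {W : ℕ → Finset V} (hW : IsExhaustion W) :
    (sampleLaw G).map (fun ω => relabel γ (jointX G W ω)) = (sampleLaw G).map (jointX G W) := by
  have h1 : (fun ω => relabel γ (jointX G W ω)) =ᵐ[sampleLaw G]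
      jointX G W ∘ pullSample γ := by
    filter_upwards [ae_good (G := G)] with ω hω using hω.relabel_jointX γ hW
  have hm : AEMeasurable (jointX G W) ((sampleLaw G).map (pullSample γ)) := by
    rw [map_pullSample]
    exact aemeasurable_jointX hW.mono
  rw [Measure.map_congr h1, ← AEMeasurable.map_map_of_aemeasurable hm
    (measurable_pullSample γ).aemeasurable, map_pullSample]

/-! ### Infinite volume -/

lemma aemeasurable_infiniteX {W : ℕ → Finset V} (hW : Monotone W) (b : BC) (θ : Param) :
    AEMeasurable (infiniteX G W b θ) (sampleLaw G) :=
  aemeasurable_of_measurable_good (measurable_infiniteX_good hW b θ)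

/-- All volumes `W' i` use the same sample, so on the finite base of a cylinder the configurations
almost surely become equal to the limit; convergence of probabilities follows. -/
lemma isInfiniteRC_map_infiniteX {W : ℕ → Finset V} (hW : IsExhaustion W) (b : BC) (θ : Param) :
    IsInfiniteRC G b θ ((sampleLaw G).map (infiniteX G W b θ)) := by
  refine ⟨Measure.isProbabilityMeasure_map (aemeasurable_infiniteX hW.mono b θ), ?_⟩
  intro W' hW' A hA
  have hAm : MeasurableSet A := .of_mem_measurableCylinders hA
  obtain ⟨s, S, -, rfl⟩ := (mem_measurableCylinders A).1 hA
  simp only [← map_finiteX]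
  rw [map_apply_of_measurable_good (measurable_infiniteX_good hW.mono b θ) hAm]
  simp only [map_apply_of_measurable_good (measurable_finiteX_good _ b θ) hAm]
  refine tendsto_measure_of_ae_tendsto_indicator_of_isFiniteMeasure _
    (measurableSet_good_inter (measurable_infiniteX_good hW.mono b θ) hAm)
    (fun i => measurableSet_good_inter (measurable_finiteX_good _ b θ) hAm) ?_
  filter_upwards [ae_good (G := G)] with ω hω
  have hev : ∀ᶠ i in atTop, ∀ e ∈ s, finiteX G (W' i) b θ ω e = infiniteX G W b θ ω e := by
    rw [Filter.eventually_all_finset]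
    intro e _
    rw [infiniteX_eq_of_exhaustions hω.nonexplosive hW hW']
    exact eventually_finiteX_eq_infiniteX hω.nonexplosive hW'.mono b θ e
  filter_upwards [hev] with i hi
  have hres : s.restrict (finiteX G (W' i) b θ ω) = s.restrict (infiniteX G W b θ ω) :=
    funext fun e => hi e.1 e.2
  simp only [mem_cylinder, hres]

end InfiniteVolume

end RandomCluster

end

/-! ### The main theorem. -/

open RandomCluster in
theorem mainTheorem4 {V : Type*} [Countable V] [Infinite V] (G : SimpleGraph V)
    [G.LocallyFinite] (W : ℕ → Finset V) (hW : IsExhaustion W) :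
    -- almost surely, all limits in the construction exist, for all parameters simultaneously
    (∀ᵐ ω ∂sampleLaw G, ∀ (b : BC) (θ : Param) (e : G.edgeSet),
      (∀ i, Tendsto (fun T : ℝ => chain G (W i) b θ ω T 0 e) atTop
        (𝓝 (finiteX G (W i) b θ ω e))) ∧
      Tendsto (fun i => finiteX G (W i) b θ ω e) atTop (𝓝 (infiniteX G W b θ ω e))) ∧
    -- the laws are the finite-volume and infinite-volume random-cluster measures
    (∀ (b : BC) (θ : Param),
      (∀ i, AEMeasurable (finiteX G (W i) b θ) (sampleLaw G) ∧
        (sampleLaw G).map (finiteX G (W i) b θ) = finiteRC G (W i) b θ) ∧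
      AEMeasurable (infiniteX G W b θ) (sampleLaw G) ∧
      IsInfiniteRC G b θ ((sampleLaw G).map (infiniteX G W b θ))) ∧
    -- almost surely, for all parameters simultaneously, all the configurations are ordered
    (∀ᵐ ω ∂sampleLaw G,
      -- the chain of free and wired configurations for fixed parameters
      (∀ θ : Param,
        (∀ i j, i ≤ j → finiteX G (W i) .free θ ω ≤ finiteX G (W j) .free θ ω) ∧
        (∀ i, finiteX G (W i) .free θ ω ≤ infiniteX G W .free θ ω) ∧
        infiniteX G W .free θ ω ≤ infiniteX G W .wired θ ω ∧
        (∀ i, infiniteX G W .wired θ ω ≤ finiteX G (W i) .wired θ ω) ∧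
        (∀ i j, i ≤ j → finiteX G (W j) .wired θ ω ≤ finiteX G (W i) .wired θ ω)) ∧
      -- monotonicity in `p` for fixed `q`
      (∀ θ₁ θ₂ : Param, θ₁.q = θ₂.q → θ₁.p ≤ θ₂.p → ∀ b : BC,
        (∀ i, finiteX G (W i) b θ₁ ω ≤ finiteX G (W i) b θ₂ ω) ∧
        infiniteX G W b θ₁ ω ≤ infiniteX G W b θ₂ ω) ∧
      -- monotonicity in `(p, q)`
      (∀ θ₁ θ₂ : Param, θ₁.p ≤ θ₂.p → θ₁.odds ≤ θ₂.odds →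
        (∀ b : BC,
          (∀ i, finiteX G (W i) b θ₁ ω ≤ finiteX G (W i) b θ₂ ω) ∧
          infiniteX G W b θ₁ ω ≤ infiniteX G W b θ₂ ω) ∧
        (∀ i, finiteX G (W i) .free θ₁ ω ≤ finiteX G (W i) .wired θ₂ ω) ∧
        infiniteX G W .free θ₁ ω ≤ infiniteX G W .wired θ₂ ω)) ∧
    -- the joint law of all infinite-volume configurations is automorphism invariant
    (AEMeasurable (jointX G W) (sampleLaw G) ∧
      ∀ γ : G ≃g G, (sampleLaw G).map (fun ω => relabel γ (jointX G W ω)) =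
        (sampleLaw G).map (jointX G W)) := by
  refine ⟨?_, fun b θ => ⟨fun i => ⟨aemeasurable_finiteX _ b θ, map_finiteX _ b θ⟩,
    aemeasurable_infiniteX hW.mono b θ, isInfiniteRC_map_infiniteX hW b θ⟩, ?_,
    aemeasurable_jointX hW.mono, fun γ => map_relabel_jointX γ hW⟩
  · filter_upwards [ae_good (G := G)] with ω hω b θ e
    refine ⟨fun i => ?_, ?_⟩
    · exact tendsto_nhds_of_eventually_eq (eventually_chain_eq_finiteX hω.nonexplosive (W i) b θ e)
    · exact tendsto_nhds_of_eventually_eq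
        (eventually_finiteX_eq_infiniteX hω.nonexplosive hW.mono b θ e)
  · filter_upwards [ae_good (G := G)] with ω hω
    have hω := hω.nonexplosive
    have hself : ∀ {θ₁ θ₂ : Param}, θ₁.Le θ₂ → ∀ b : BC,
        (∀ i, finiteX G (W i) b θ₁ ω ≤ finiteX G (W i) b θ₂ ω) ∧
        infiniteX G W b θ₁ ω ≤ infiniteX G W b θ₂ ω := by
      intro θ₁ θ₂ hθ b
      have h : ∀ i, finiteX G (W i) b θ₁ ω ≤ finiteX G (W i) b θ₂ ω := fun i =>
        finiteX_le_of_chain_le hω (chain_self_mono hω (W i) b hθ)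
      exact ⟨h, infiniteX_le_of_finiteX_le hω hW.mono h⟩
    have hfw : ∀ {θ₁ θ₂ : Param}, θ₁.Le θ₂ →
        (∀ i, finiteX G (W i) .free θ₁ ω ≤ finiteX G (W i) .wired θ₂ ω) ∧
        infiniteX G W .free θ₁ ω ≤ infiniteX G W .wired θ₂ ω := by
      intro θ₁ θ₂ hθ
      have h : ∀ i, finiteX G (W i) .free θ₁ ω ≤ finiteX G (W i) .wired θ₂ ω := fun i =>
        finiteX_le_of_chain_le hω (chain_free_le_wired hω (W i) hθ)
      exact ⟨h, infiniteX_le_of_finiteX_le hω hW.mono h⟩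
    refine ⟨fun θ => ⟨fun i j hij => ?_, fun i => finiteX_free_le_infiniteX hω hW θ,
      (hfw (.refl θ)).2, fun i => infiniteX_le_finiteX_wired hω hW θ, fun i j hij => ?_⟩,
      fun θ₁ θ₂ hq hp b => hself (.of_q_eq hq hp) b,
      fun θ₁ θ₂ hp ho => ⟨hself (.of_odds hp ho), hfw (.of_odds hp ho)⟩⟩
    · exact finiteX_le_of_chain_le hω (chain_free_le hω (hW.mono hij) (.refl θ))
    · exact finiteX_le_of_chain_le hω (chain_wired_le hω (hW.mono hij) (.refl θ))
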